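/- Let $V$ be a finite-dimensional complex Hilbert space (the one-particle space), $m=\dim V$, $N\ge 0$, and let $S_N$ act on $V^{\otimes N}$ by exchanging the factors. For a Hermitian operator $h$ on $V$ with eigenvalues $\varepsilon_1,\dots,\varepsilon_m$ let $H_N(h)=\sum_{i=1}^N 1\otimes\cdots\otimes h\otimes\cdots\otimes 1$ be the Hamiltonian of the ideal gas of $N$ particles. A system of $N$ identical particles consists of a number $k$ of components, a set $\mathfrak h$ of Hamiltonians on $V^{\otimes N}$ which contains $H_N(h)$ for every Hermitian $h$, and a subspace $\mathcal H\subseteq (V^{\otimes N})^k$ of states (wave functions with $k$ components, $k=1$ being the scalar case) which is preserved by every $H\in\mathfrak h$ acting componentwise. Its canonical partition function for the one-particle Hamiltonian $h$ is $Z(\beta,N)=\operatorname{tr}_{\mathcal H}e^{-\beta H_N(h)}$. Let $W$ be the space of all linear maps $\Phi:\mathcal H\to V^{\otimes N}$ with $\Phi(H\Psi)=H\,\Phi(\Psi)$ for all $H\in\mathfrak h$ and $\Psi\in\mathcal H$ (the scalar wave functions representing the states of the system). For a partition $I$ of $N$ let $D^I$ be the representation of $S_N$ on the Specht module of $I$ (the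 left ideal of $\mathbb C[S_N]$ generated by the Young symmetrizer of $I$), $\chi^I$ its character, and $$s_I(x_1,x_2,\dots)=\frac1{N!}\sum_{\sigma\in S_N}\chi^I(\sigma)\prod_{r\ge1}\Big(\sum_i x_i^{r}\Big)^{a_r(\sigma)}$$ the corresponding Schur function, where $a_r(\sigma)$ is the number of cycles of length $r$ of $\sigma$. Suppose that the Hamiltonians are invariant under permutations: $[H,\sigma]=0$ for all $H\in\mathfrak h$ and $\sigma\in S_N$. Then: (1) The representations $D^I$ are irreducible and pairwise inequivalent, and $W$ is spanned by the maps $\Psi\mapsto\sigma\Psi_a$ with $\sigma\in S_N$ and $1\le a\le k$, that is, by the components of the wave function with their particles exchanged. (2) There are non-negative integers $C_I$ such that, for every Hermitian $h$ and every real $\beta$, $$Z(\beta,N)=\sum_I C_I\,s_I\big(e^{-\beta\varepsilon_1},\dots,e^{-\beta\varepsilon_m}\big),$$ and, for these $C_I$, the space $W$ has a basis $|\Phi\rangle=(\Phi_j)_j$ on which exchanging particles acts by a matrix phase: for all $\sigma\in S_N$, in particular for the exchange $\sigma_{ij}$ of two particles, $\sigma|\Phi\rangle=D(\sigma)|\Phi\rangle$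 with the block diagonal matrix $$D(\sigma)=\bigoplus_I\big[D^I(\sigma)\big]^{\oplus C_I},$$ which means $\sigma\,\Phi_j(\Psi)=\sum_{j'}D(\sigma)_{j'j}\,\Phi_{j'}(\Psi)$ for every state $\Psi\in\mathcal H$. (3) If $N\le m$, the $C_I$ are determined by the partition function: if $\beta\ne0$ and complex numbers $c_I$ satisfy $Z(\beta,N)=\sum_I c_I s_I(e^{-\beta\varepsilon_1},\dots,e^{-\beta\varepsilon_m})$ for every Hermitian $h$, then $c_I=C_I$ for all $I$. (4) Let $N\le m$. For Bose statistics ($k=1$ and $\mathcal H$ is the space of all symmetric tensors) $C_{(N)}=1$, all other $C_I$ vanish, and $D(\sigma)$ is the $1\times1$ matrix $1$. For Fermi statistics ($k=1$ and $\mathcal H$ is the space of all antisymmetric tensors) $C_{(1^N)}=1$, all other $C_I$ vanish, and $D(\sigma)$ is the $1\times 1$ matrix $\operatorname{sgn}\sigma$; in particular $D(\sigma_{ij})=-1$ for $i\neq j$. -/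

import Mathlib

open scoped TensorProduct

noncomputable section

/-! ### Irreducible representations of the symmetric group, labelled by integer partitions -/

/-- The parts `λ₁ ≥ λ₂ ≥ … ≥ λ_l > 0` of an integer partition, in decreasing order. -/
def rowLengths {N : ℕ} (I : N.Partition) : List ℕ :=
  I.parts.sort (· ≥ ·)

theorem sum_rowLengths {N : ℕ} (I : N.Partition) :
    ∑ i : Fin (rowLengths I).length, (rowLengths I).get i = N := by
  have h : (rowLengths I).sum = N := by
    rw [rowLengths, ← Multiset.sum_coe, Multiset.sort_eq, I.parts_sum]
  rw [← List.sum_ofFn, List.ofFn_get, h]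

/-- The boxes of the Young diagram of `I`: pairs (row `i`, column `j`) with `j < λ_i`. -/
abbrev Box {N : ℕ} (I : N.Partition) : Type :=
  (i : Fin (rowLengths I).length) × Fin ((rowLengths I).get i)

/-- The tableau of shape `I` that is filled with `0, 1, …, N - 1` row by row. -/
def tableau {N : ℕ} (I : N.Partition) : Fin N ≃ Box I :=
  (finCongr (sum_rowLengths I).symm).trans finSigmaFinEquiv.symm

/-- The permutations that preserve every row of the tableau. -/
def rowGroup {N : ℕ} (I : N.Partition) : Finset (Equiv.Perm (Fin N)) :=
  Finset.univ.filter fun σ => ∀ x, (tableau I (σ x)).1 = (tableau I x).1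

/-- The permutations that preserve every column of the tableau. -/
def columnGroup {N : ℕ} (I : N.Partition) : Finset (Equiv.Perm (Fin N)) :=
  Finset.univ.filter fun σ => ∀ x, ((tableau I (σ x)).2 : ℕ) = ((tableau I x).2 : ℕ)

/-- The Young symmetrizer of the partition `I`, in the group algebra of `S_N`. -/
def youngSymmetrizer {N : ℕ} (I : N.Partition) : MonoidAlgebra ℂ (Equiv.Perm (Fin N)) :=
  (∑ p ∈ rowGroup I, MonoidAlgebra.of ℂ _ p) *
    (∑ q ∈ columnGroup I, ((Equiv.Perm.sign q : ℤ) : ℂ) • MonoidAlgebra.of ℂ _ q)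

/-- The Specht module of `I`: the left ideal generated by the Young symmetrizer. -/
def spechtModule {N : ℕ} (I : N.Partition) :
    Submodule ℂ (MonoidAlgebra ℂ (Equiv.Perm (Fin N))) :=
  LinearMap.range (LinearMap.mulRight ℂ (youngSymmetrizer I))

theorem mul_mem_spechtModule {N : ℕ} (I : N.Partition)
    (a x : MonoidAlgebra ℂ (Equiv.Perm (Fin N))) (hx : x ∈ spechtModule I) :
    LinearMap.mulLeft ℂ a x ∈ spechtModule I := by
  obtain ⟨y, rfl⟩ := hx
  exact ⟨a * y, by simp [mul_assoc]⟩

/-- The irreducible representation `D^I` of `S_N` that corresponds to the partition `I`: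
left multiplication on the Specht module. -/
def spechtRep {N : ℕ} (I : N.Partition) :
    Representation ℂ (Equiv.Perm (Fin N)) (spechtModule I) where
  toFun σ := (LinearMap.mulLeft ℂ (MonoidAlgebra.of ℂ _ σ)).restrict
    (mul_mem_spechtModule I (MonoidAlgebra.of ℂ _ σ))
  map_one' := by
    ext x
    simp [LinearMap.restrict_apply, ← MonoidAlgebra.one_def]
  map_mul' σ τ := by
    refine LinearMap.ext fun x => Subtype.ext ?_
    simp only [LinearMap.restrict_apply, LinearMap.mulLeft_apply, map_mul, mul_assoc,
      Module.End.mul_apply]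

/-- The matrix `D^I(σ)`, in a fixed basis of the Specht module. -/
def spechtMatrix {N : ℕ} (I : N.Partition) (σ : Equiv.Perm (Fin N)) :
    Matrix (Fin (Module.finrank ℂ (spechtModule I))) (Fin (Module.finrank ℂ (spechtModule I))) ℂ :=
  LinearMap.toMatrix (Module.finBasis ℂ (spechtModule I)) (Module.finBasis ℂ (spechtModule I))
    (spechtRep I σ)

/-- The simple characteristic (irreducible character) `χ^I` of `S_N`. -/
def simpleCharacter {N : ℕ} (I : N.Partition) (σ : Equiv.Perm (Fin N)) : ℂ :=
  LinearMap.trace ℂ (spechtModule I) (spechtRep I σ)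

/-- The S-function (Schur function)
`s_I(x) = (1 / N!) ∑_σ χ^I(σ) ∏_m (∑_i x_i ^ m) ^ (number of cycles of length m of σ)`,
where `σ.partition.parts` is the multiset of all cycle lengths of `σ`, fixed points included. The
sum over `σ` collects, for the cycle type `J`, exactly `g_J = N! / ∏_m (m ^ a_{J,m} a_{J,m}!)`
equal terms. -/
def schurFunction {N : ℕ} (I : N.Partition) {ι : Type*} [Fintype ι] (x : ι → ℂ) : ℂ :=
  ((N.factorial : ℂ))⁻¹ * ∑ σ : Equiv.Perm (Fin N),
    simpleCharacter I σ * (σ.partition.parts.map fun m => ∑ i, x i ^ m).prod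

/-- The partition `(1^N)`. -/
def onesPartition (N : ℕ) : N.Partition :=
  Nat.Partition.ofSums N (Multiset.replicate N 1) (by simp)

/-- The indices of the rows and columns of the matrix phase `⨁_I [D^I]^{⊕ C_I}`. -/
abbrev PhaseIndex {N : ℕ} (C : N.Partition → ℕ) : Type :=
  (I : N.Partition) × (Fin (Module.finrank ℂ (spechtModule I)) × Fin (C I))

/-- The block diagonal matrix `D(σ) = ⨁_I [D^I(σ)]^{⊕ C_I}`. -/
def permutationPhase {N : ℕ} (C : N.Partition → ℕ) (σ : Equiv.Perm (Fin N)) :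
    Matrix (PhaseIndex C) (PhaseIndex C) ℂ :=
  Matrix.blockDiagonal' fun I => Matrix.blockDiagonal fun _ : Fin (C I) => spechtMatrix I σ

/-! ### Systems of `N` identical particles -/

section Particles

variable (V : Type*) [NormedAddCommGroup V] [InnerProductSpace ℂ V] (N : ℕ)

/-- The space `V^{⊗N}` of the (scalar) wave functions of `N` particles. -/
abbrev NParticle : Type _ := ⨂[ℂ] _ : Fin N, V

/-- The action of `S_N` on `V^{⊗N}` by exchanging the particles:
`σ (v_1 ⊗ … ⊗ v_N)` has the factor `v_i` in position `σ i`. -/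
def exchange : Representation ℂ (Equiv.Perm (Fin N)) (NParticle V N) where
  toFun σ := (PiTensorProduct.reindex ℂ (fun _ : Fin N => V) σ).toLinearMap
  map_one' := by
    refine PiTensorProduct.ext (MultilinearMap.ext fun v => ?_)
    exact PiTensorProduct.reindex_tprod (R := ℂ) (s := fun _ : Fin N => V) 1 v
  map_mul' σ τ := by
    refine PiTensorProduct.ext (MultilinearMap.ext fun v => ?_)
    refine (PiTensorProduct.reindex_tprod (R := ℂ) (s := fun _ : Fin N => V) (σ * τ) v).trans ?_
    refine Eq.trans ?_ (congrArg (PiTensorProduct.reindex ℂ (fun _ : Fin N => V) σ)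
      (PiTensorProduct.reindex_tprod (R := ℂ) (s := fun _ : Fin N => V) τ v).symm)
    exact (PiTensorProduct.reindex_tprod (R := ℂ) (s := fun _ : Fin N => V) σ
      (fun i => v (τ.symm i))).symm

variable {V}

/-- The Hamiltonian `H_N = ∑_i 1 ⊗ … ⊗ h ⊗ … ⊗ 1` of the ideal gas with one-particle
Hamiltonian `h`. -/
def idealHamiltonian (h : V →ₗ[ℂ] V) : Module.End ℂ (NParticle V N) :=
  ∑ i : Fin N, PiTensorProduct.map (Function.update (fun _ => LinearMap.id) i h)

/-- The trace of `exp (-β T)` for an operator `T` on a finite dimensional space. -/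
def gibbsTrace {M : Type*} [AddCommGroup M] [Module ℂ M] [FiniteDimensional ℂ M]
    (β : ℝ) (T : Module.End ℂ M) : ℂ :=
  (NormedSpace.exp ((-β : ℂ) •
    LinearMap.toMatrix (Module.finBasis ℂ M) (Module.finBasis ℂ M) T)).trace

variable (V)

/-- A system of `N` identical particles. Its states are wave functions with finitely many components
in `V^{⊗N}`, on which the Hamiltonians act componentwise; they form a subspace that does not depend
on the forces: it is preserved by the Hamiltonian of the ideal gas for every Hermitian one-particle
Hamiltonian, and by the other Hamiltonians (if any) that are considered for the system. -/
structure ParticleSystem where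
  /-- The number of components of the wave functions. -/
  components : ℕ
  /-- The Hilbert subspace that describes the system. -/
  states : Submodule ℂ (Fin components → NParticle V N)
  /-- The Hamiltonians of the system. -/
  hamiltonians : Set (Module.End ℂ (NParticle V N))
  ideal_mem : ∀ h : V →ₗ[ℂ] V, h.IsSymmetric → idealHamiltonian N h ∈ hamiltonians
  preserved : ∀ H ∈ hamiltonians, ∀ Ψ ∈ states, H.compLeft (Fin components) Ψ ∈ states

variable {V} {N}

namespace ParticleSystem

variable (S : ParticleSystem V N)

/-- A Hamiltonian of the system, as an operator on the space of states. -/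
def onStates (H : Module.End ℂ (NParticle V N)) (hH : H ∈ S.hamiltonians) :
    Module.End ℂ S.states :=
  (H.compLeft (Fin S.components)).restrict (S.preserved H hH)

/-- `[H, S_N] = 0` for the Hamiltonians of the system. -/
def PermutationInvariant : Prop :=
  ∀ H ∈ S.hamiltonians, ∀ σ : Equiv.Perm (Fin N), exchange V N σ * H = H * exchange V N σ

/-- The canonical partition function `Z(β, N) = tr exp (-β H_N)` of the ideal gas, the trace being
taken over the states of the system. -/
def partitionFunction [FiniteDimensional ℂ V] (h : V →ₗ[ℂ] V) (hh : h.IsSymmetric) (β : ℝ) : ℂ :=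
  gibbsTrace β (S.onStates (idealHamiltonian N h) (S.ideal_mem h hh))

/-- The scalar wave functions that represent the states of the system: the linear rules `Φ` which
assign to every state `Ψ` a vector `Φ Ψ` of `V^{⊗N}` such that the Hamiltonians of the system act on
`Φ Ψ` as they act on `Ψ` (in particular `Φ Ψ` has the energy of `Ψ` when `Ψ` has one). -/
def waveFunctions : Submodule ℂ (S.states →ₗ[ℂ] NParticle V N) where
  carrier := {Φ | ∀ H (hH : H ∈ S.hamiltonians) (Ψ : S.states), Φ (S.onStates H hH Ψ) = H (Φ Ψ)}
  zero_mem' := by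
    intro H hH Ψ
    simp
  add_mem' := by
    intro Φ Φ' h h' H hH Ψ
    simp [h H hH Ψ, h' H hH Ψ]
  smul_mem' := by
    intro c Φ h H hH Ψ
    simp [h H hH Ψ]

/-- The `k`-th component of the wave function of a state. -/
def component (k : Fin S.components) : S.states →ₗ[ℂ] NParticle V N :=
  LinearMap.proj k ∘ₗ S.states.subtype

/-- Bose statistics: the states are all the symmetric scalar wave functions. -/
def IsBose : Prop :=
  S.components = 1 ∧ ∀ Ψ, Ψ ∈ S.states ↔
    ∀ (σ : Equiv.Perm (Fin N)) (k : Fin S.components), exchange V N σ (Ψ k) = Ψ k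

/-- Fermi statistics: the states are all the antisymmetric scalar wave functions. -/
def IsFermi : Prop :=
  S.components = 1 ∧ ∀ Ψ, Ψ ∈ S.states ↔
    ∀ (σ : Equiv.Perm (Fin N)) (k : Fin S.components),
      exchange V N σ (Ψ k) = ((Equiv.Perm.sign σ : ℤ) : ℂ) • Ψ k

end ParticleSystem

end Particles

end

/-!
The proof compares two algebras of operators on `V^{⊗N}`: the one generated by the Hamiltonians of
the ideal gas, and the group algebra of `S_N`.

*Specht modules.* A transposition of two elements which share a row of one tableau and a column of
another is absorbed by the row symmetrizer and by the column antisymmetrizer with opposite signs, so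
`a_I g b_J ≠ 0` forces `I` to be dominated by `J`, and for `I = J` it forces `g` to be the product
of a row and a column permutation. Hence `c_I x c_I` is a multiple of the Young symmetrizer `c_I`,
and together with the semisimplicity of `ℂ[S_N]` this gives the irreducibility
(`spechtRep_isIrreducible`) and the inequivalence (`eq_of_spechtRep_equiv`) of the Specht modules.
Their characters are linearly independent functions of the cycle type, and there are as many cycle
types as partitions, so there are no other irreducible representations
(`exists_equiv_spechtRep`), and every representation of `S_N` has a basis in which it is a matrix
phase (`exists_basis_permutationPhase`).

*Duality.* The Hamiltonians of the ideal gas generate all operators that commute with `S_N`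
(`mem_of_commute_exchange`). So such operators preserve the states and commute with the scalar wave
functions `W`. An equivariant linear map from `Hom(ℋ, V^{⊗N})` to `V^{⊗N}` is a sum of evaluations
at states followed by operators that commute with `S_N`; on `W` it is therefore the evaluation at a
single state (`exists_state_of_equivariant`). Maschke's theorem then shows that `W` is spanned by
the permuted components (`waveFunctions_eq_span`), and that `ℋ` is the space of equivariant maps
from `W` to `V^{⊗N}` (`evalMap_bijective`).

*Partition function.* Consequently the trace over `ℋ` of an operator `D` that commutes with `S_N` is
the average over `σ` of `χ_W(σ⁻¹) tr (D σ)` (`trace_states`). For `D = exp (-β H_N)`, the `N`-th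
tensor power of `exp (-β h)`, the trace `tr (D σ)` is the product of the power sums of the
Boltzmann factors over the cycles of `σ` (`trace_map_mul_exchange`). Decomposing `W` gives the
expansion in Schur functions, whose coefficients are the multiplicities of the Specht modules in `W`
(`partitionFunction_eq_sum_schurFunction`).

*Uniqueness.* For `N ≤ dim V`, the products of power sums of degree `N` are linearly independent
by Newton's identities (`linearIndependent_psumPart`), so the partition function determines the
character of `W`, and with it the multiplicities (`eq_of_partitionFunction_eq`).

*Bose and Fermi statistics.* Here `W` is the line spanned by the only component, which is non-zero
because of `N ≤ dim V`. Permutations act on it by `1` or by the sign, and the only Specht modules on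
which they act in this way are those of `(N)` and `(1^N)`.
-/

noncomputable section

/-! ### Young tableaux -/

/-- The row of the box of the tableau of shape `I` that contains `x`. -/
def boxRow {N : ℕ} (I : N.Partition) (x : Fin N) : ℕ := (tableau I x).1

/-- The column of the box of the tableau of shape `I` that contains `x`. -/
def boxCol {N : ℕ} (I : N.Partition) (x : Fin N) : ℕ := (tableau I x).2

theorem mem_rowGroup {N : ℕ} {I : N.Partition} {σ : Equiv.Perm (Fin N)} :
    σ ∈ rowGroup I ↔ ∀ x, boxRow I (σ x) = boxRow I x := by
  simp [rowGroup, boxRow, Fin.ext_iff]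

theorem mem_columnGroup {N : ℕ} {I : N.Partition} {σ : Equiv.Perm (Fin N)} :
    σ ∈ columnGroup I ↔ ∀ x, boxCol I (σ x) = boxCol I x := by
  simp [columnGroup, boxCol]

theorem box_injective {N : ℕ} (I : N.Partition) {x y : Fin N} (h : boxRow I x = boxRow I y)
    (h' : boxCol I x = boxCol I y) : x = y := by
  apply (tableau I).injective
  have h1 : (tableau I x).1 = (tableau I y).1 := Fin.ext h
  exact Sigma.ext h1 ((Fin.heq_ext_iff (by rw [h1])).2 h')

theorem exists_box {N : ℕ} (I : N.Partition) (i j : ℕ) (hi : i < (rowLengths I).length)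
    (hj : j < (rowLengths I)[i]) : ∃ x, boxRow I x = i ∧ boxCol I x = j :=
  ⟨(tableau I).symm ⟨⟨i, hi⟩, ⟨j, hj⟩⟩, by simp [boxRow], by rw [boxCol, Equiv.apply_symm_apply]⟩

theorem boxRow_lt {N : ℕ} (I : N.Partition) (x : Fin N) : boxRow I x < (rowLengths I).length :=
  (tableau I x).1.2

theorem boxCol_lt {N : ℕ} (I : N.Partition) (x : Fin N) :
    boxCol I x < (rowLengths I)[boxRow I x]'(boxRow_lt I x) :=
  (tableau I x).2.2

theorem mem_rowLengths {N : ℕ} {I : N.Partition} {n : ℕ} : n ∈ rowLengths I ↔ n ∈ I.parts := by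
  simp [rowLengths]

/-- The rows of a Young diagram get shorter downwards, so the boxes above a box are boxes. -/
theorem exists_box_above {N : ℕ} (I : N.Partition) (y : Fin N) (i : ℕ) (hi : i < boxRow I y) :
    ∃ z, boxRow I z = i ∧ boxCol I z = boxCol I y := by
  have hy := boxRow_lt I y
  refine exists_box I i _ (hi.trans hy) ((boxCol_lt I y).trans_le ?_)
  have h : (rowLengths I).Pairwise (· ≥ ·) := Multiset.pairwise_sort _ _
  exact List.pairwise_iff_getElem.1 h i _ (hi.trans hy) hy hi

open Finset in
theorem card_boxRow_eq {N : ℕ} (I : N.Partition) (i : ℕ) :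
    #{x | boxRow I x = i} = (rowLengths I).getD i 0 := by
  by_cases hi : i < (rowLengths I).length
  · rw [List.getD_eq_getElem _ _ hi, ← card_range ((rowLengths I)[i])]
    refine card_bij (fun x _ => boxCol I x) ?_ ?_ ?_
    · intro x hx
      simp only [mem_filter, mem_univ, true_and] at hx
      subst hx
      simpa using boxCol_lt I x
    · intro x hx y hy h
      simp only [mem_filter, mem_univ, true_and] at hx hy
      exact box_injective I (hx.trans hy.symm) h
    · intro j hj
      obtain ⟨x, h1, h2⟩ := exists_box I i j hi (mem_range.1 hj)
      exact ⟨x, by simpa using h1, h2⟩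
  · rw [List.getD_eq_default _ _ (by omega), card_eq_zero, filter_eq_empty_iff]
    intro x _ h
    have := boxRow_lt I x
    omega

theorem List.eq_of_getD_eq_of_pos {l l' : List ℕ} (hl : ∀ a ∈ l, 0 < a) (hl' : ∀ a ∈ l', 0 < a)
    (h : ∀ i, l.getD i 0 = l'.getD i 0) : l = l' := by
  have key : ∀ {l l' : List ℕ}, (∀ a ∈ l', 0 < a) → (∀ i, l.getD i 0 = l'.getD i 0) →
      l'.length ≤ l.length := by
    intro l l' hl' h
    by_contra hlt
    have h1 := h l.length
    rw [List.getD_eq_default _ _ le_rfl, List.getD_eq_getElem _ _ (by omega)] at h1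
    have := hl' _ (List.getElem_mem (l := l') (n := l.length) (by omega))
    omega
  have hlen := le_antisymm (key hl (fun i => (h i).symm)) (key hl' h)
  refine List.ext_getElem hlen fun i h1 h2 => ?_
  have := h i
  rwa [List.getD_eq_getElem _ _ h1, List.getD_eq_getElem _ _ h2] at this

open Finset in
/-- A partition is determined by the numbers of boxes in its first `r` rows. -/
theorem partition_ext_of_card {N : ℕ} {I J : N.Partition}
    (h : ∀ r, #{x | boxRow I x < r} = #{x | boxRow J x < r}) : I = J := by
  have hsplit : ∀ (K : N.Partition) (r : ℕ),
      #{x | boxRow K x < r + 1} = #{x | boxRow K x < r} + #{x | boxRow K x = r} := by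
    intro K r
    rw [← card_union_of_disjoint]
    · congr 1
      ext x
      simp only [mem_filter, mem_univ, true_and, mem_union]
      omega
    · rw [disjoint_filter]
      intro x _ h1 h2
      omega
  have hrow : rowLengths I = rowLengths J := by
    refine List.eq_of_getD_eq_of_pos (fun a ha => I.parts_pos (mem_rowLengths.1 ha))
      (fun a ha => J.parts_pos (mem_rowLengths.1 ha)) fun i => ?_
    rw [← card_boxRow_eq, ← card_boxRow_eq]
    have h1 := hsplit I i
    have h2 := hsplit J i
    have h3 := h i
    have h4 := h (i + 1)
    omega
  apply Nat.Partition.ext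
  rw [← Multiset.sort_eq I.parts (· ≥ ·), ← Multiset.sort_eq J.parts (· ≥ ·)]
  exact congrArg _ hrow

/-! ### The counting argument behind the dominance order -/

section Counting

open Finset

variable {α : Type*} [Fintype α] {row col u : α → ℕ} (e : α ≃ α)

/-- Suppose that `(row, col)` places the elements of `α` on the boxes of a diagram whose columns
have no gaps. If the elements of `α` are distributed over rows by `u` so that no two elements of a
row lie in one column of the diagram (permuted by `e`), then the first `r` rows contain no more
elements of a given column than the first `r` rows of the diagram do. -/
theorem card_column_le (habove : ∀ y, ∀ i < row y, ∃ z, row z = i ∧ col z = col y)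
    (hu : ∀ x y, u x = u y → col (e x) = col (e y) → x = y) (r j : ℕ) :
    #{x | u x < r ∧ col (e x) = j} ≤ #{y | row y < r ∧ col y = j} := by
  by_cases h : ∃ y, col y = j ∧ r ≤ row y
  · obtain ⟨y, rfl, hr⟩ := h
    have h1 : #{x | u x < r ∧ col (e x) = col y} ≤ #(range r) := by
      refine card_le_card_of_injOn u ?_ ?_
      · intro x hx
        simp only [coe_filter, mem_univ, true_and, Set.mem_ofPred_eq] at hx
        simpa using hx.1
      · intro x hx x' hx' hxx
        simp only [coe_filter, mem_univ, true_and, Set.mem_ofPred_eq] at hx hx'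
        exact hu x x' hxx (hx.2.trans hx'.2.symm)
    refine h1.trans ?_
    refine card_le_card_of_surjOn row ?_
    intro i hi
    simp only [coe_range, Set.mem_Iio] at hi
    obtain ⟨z, hz, hz'⟩ := habove y i (by omega)
    exact ⟨z, by simp [hz, hz', hi], hz⟩
  · push Not at h
    refine card_le_card_of_injOn e ?_ e.injective.injOn
    intro x hx
    simp only [coe_filter, mem_univ, true_and, Set.mem_ofPred_eq] at hx ⊢
    exact ⟨h _ hx.2, hx.2⟩

theorem card_eq_sum_card_column (v : α → ℕ) (t : Finset ℕ) (ht : ∀ x, v x ∈ t) (r : ℕ) :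
    #{x | u x < r} = ∑ j ∈ t, #{x | u x < r ∧ v x = j} := by
  rw [card_eq_sum_card_fiberwise (f := v) (t := t) fun x _ => ht x]
  simp only [filter_filter]

/-- The counting part of the dominance order: `card_column_le`, summed over the columns. -/
theorem card_rows_le (habove : ∀ y, ∀ i < row y, ∃ z, row z = i ∧ col z = col y)
    (hu : ∀ x y, u x = u y → col (e x) = col (e y) → x = y) (r : ℕ) :
    #{x | u x < r} ≤ #{y | row y < r} := by
  classical
  rw [card_eq_sum_card_column (fun x => col (e x)) (univ.image col) (fun x => by simp) r,
    card_eq_sum_card_column col (univ.image col) (fun x => by simp) r]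
  exact sum_le_sum fun j _ => card_column_le e habove hu r j

/-- If moreover `u` is the row function of the diagram itself, all inequalities of
`card_column_le` are equalities, so the box in the row of `x` and the column of `e x` exists. -/
theorem exists_box_of_row_col (habove : ∀ y, ∀ i < row y, ∃ z, row z = i ∧ col z = col y)
    (hu : ∀ x y, row x = row y → col (e x) = col (e y) → x = y) (x : α) :
    ∃ y, row y = row x ∧ col y = col (e x) := by
  classical
  have heq : ∀ r, #{z | row z < r ∧ col (e z) = col (e x)} =
      #{y | row y < r ∧ col y = col (e x)} := by
    intro r
    have hsum := card_eq_sum_card_column (u := row) (fun x => col (e x)) (univ.image col)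
      (fun x => by simp) r
    rw [card_eq_sum_card_column (u := row) col (univ.image col) (fun x => by simp) r] at hsum
    exact (sum_eq_sum_iff_of_le fun j _ => card_column_le e habove hu r j).1 hsum.symm
      (col (e x)) (by simp)
  by_contra! hne
  have h1 : #{z | row z < row x ∧ col (e z) = col (e x)} <
      #{z | row z < row x + 1 ∧ col (e z) = col (e x)} := by
    refine card_lt_card ⟨?_, fun hsub => ?_⟩
    · intro z hz
      simp only [mem_filter, mem_univ, true_and] at hz ⊢
      omega
    · have := @hsub x (by simp)
      simp at this
  rw [heq, heq] at h1
  refine h1.not_ge (card_le_card fun y hy => ?_)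
  simp only [mem_filter, mem_univ, true_and] at hy ⊢
  refine ⟨lt_of_le_of_ne (by omega) fun h => hne y h hy.2, hy.2⟩

end Counting

/-! ### The Young symmetrizers -/

section YoungSymmetrizer

open Equiv MonoidAlgebra

variable {N : ℕ}

/-- The sum of the permutations in the row group. -/
def rowSymmetrizer (I : N.Partition) : MonoidAlgebra ℂ (Perm (Fin N)) :=
  ∑ p ∈ rowGroup I, of ℂ _ p

/-- The alternating sum of the permutations in the column group. -/
def columnAntisymmetrizer (I : N.Partition) : MonoidAlgebra ℂ (Perm (Fin N)) :=
  ∑ q ∈ columnGroup I, ((Perm.sign q : ℤ) : ℂ) • of ℂ _ q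

theorem youngSymmetrizer_eq (I : N.Partition) :
    youngSymmetrizer I = rowSymmetrizer I * columnAntisymmetrizer I := rfl

theorem inv_mem_rowGroup {I : N.Partition} {p : Perm (Fin N)} (hp : p ∈ rowGroup I) :
    p⁻¹ ∈ rowGroup I := by
  rw [mem_rowGroup] at hp ⊢
  intro x
  simpa using (hp (p⁻¹ x)).symm

theorem inv_mem_columnGroup {I : N.Partition} {q : Perm (Fin N)} (hq : q ∈ columnGroup I) :
    q⁻¹ ∈ columnGroup I := by
  rw [mem_columnGroup] at hq ⊢
  intro x
  simpa using (hq (q⁻¹ x)).symm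

theorem mul_mem_rowGroup {I : N.Partition} {p p' : Perm (Fin N)} (hp : p ∈ rowGroup I)
    (hp' : p' ∈ rowGroup I) : p * p' ∈ rowGroup I := by
  rw [mem_rowGroup] at hp hp' ⊢
  intro x
  rw [Perm.mul_apply, hp, hp']

theorem mul_mem_columnGroup {I : N.Partition} {q q' : Perm (Fin N)} (hq : q ∈ columnGroup I)
    (hq' : q' ∈ columnGroup I) : q * q' ∈ columnGroup I := by
  rw [mem_columnGroup] at hq hq' ⊢
  intro x
  rw [Perm.mul_apply, hq, hq']

theorem rowSymmetrizer_mul {I : N.Partition} {p : Perm (Fin N)} (hp : p ∈ rowGroup I) :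
    rowSymmetrizer I * of ℂ _ p = rowSymmetrizer I := by
  rw [rowSymmetrizer, Finset.sum_mul]
  refine Finset.sum_bij' (fun g _ => g * p) (fun g _ => g * p⁻¹) ?_ ?_ ?_ ?_ ?_
  · exact fun g hg => mul_mem_rowGroup hg hp
  · exact fun g hg => mul_mem_rowGroup hg (inv_mem_rowGroup hp)
  · simp
  · simp
  · simp

theorem mul_rowSymmetrizer {I : N.Partition} {p : Perm (Fin N)} (hp : p ∈ rowGroup I) :
    of ℂ _ p * rowSymmetrizer I = rowSymmetrizer I := by
  rw [rowSymmetrizer, Finset.mul_sum]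
  refine Finset.sum_bij' (fun g _ => p * g) (fun g _ => p⁻¹ * g) ?_ ?_ ?_ ?_ ?_
  · exact fun g hg => mul_mem_rowGroup hp hg
  · exact fun g hg => mul_mem_rowGroup (inv_mem_rowGroup hp) hg
  · simp
  · simp
  · simp

theorem mul_columnAntisymmetrizer {I : N.Partition} {q : Perm (Fin N)} (hq : q ∈ columnGroup I) :
    of ℂ _ q * columnAntisymmetrizer I = ((Perm.sign q : ℤ) : ℂ) • columnAntisymmetrizer I := by
  rw [columnAntisymmetrizer, Finset.mul_sum, Finset.smul_sum]
  refine Finset.sum_bij' (fun g _ => q * g) (fun g _ => q⁻¹ * g) ?_ ?_ ?_ ?_ ?_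
  · exact fun g hg => mul_mem_columnGroup hq hg
  · exact fun g hg => mul_mem_columnGroup (inv_mem_columnGroup hq) hg
  · simp
  · simp
  · intro g hg
    rw [mul_smul_comm, ← map_mul, smul_smul]
    congr 1
    obtain h | h := Int.units_eq_one_or (Perm.sign q) <;> simp [h]

theorem columnAntisymmetrizer_mul {I : N.Partition} {q : Perm (Fin N)} (hq : q ∈ columnGroup I) :
    columnAntisymmetrizer I * of ℂ _ q = ((Perm.sign q : ℤ) : ℂ) • columnAntisymmetrizer I := by
  rw [columnAntisymmetrizer, Finset.sum_mul, Finset.smul_sum]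
  refine Finset.sum_bij' (fun g _ => g * q) (fun g _ => g * q⁻¹) ?_ ?_ ?_ ?_ ?_
  · exact fun g hg => mul_mem_columnGroup hg hq
  · exact fun g hg => mul_mem_columnGroup hg (inv_mem_columnGroup hq)
  · simp
  · simp
  · intro g hg
    rw [smul_mul_assoc, ← map_mul, smul_smul]
    congr 1
    obtain h | h := Int.units_eq_one_or (Perm.sign q) <;> simp [h]

theorem swap_mem_rowGroup {I : N.Partition} {x y : Fin N} (h : boxRow I x = boxRow I y) :
    swap x y ∈ rowGroup I := by
  rw [mem_rowGroup]
  intro z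
  rw [swap_apply_def]
  split_ifs with h1 h2 <;> simp_all

theorem swap_mem_columnGroup {I : N.Partition} {x y : Fin N} (h : boxCol I x = boxCol I y) :
    swap x y ∈ columnGroup I := by
  rw [mem_columnGroup]
  intro z
  rw [swap_apply_def]
  split_ifs with h1 h2 <;> simp_all

/-- If `x` and `y` are in one row of the tableau of `I`, and in one column of the tableau of `J`
permuted by `g`, then the transposition of `x` and `y` is absorbed by both symmetrizers, but with
different signs. -/
theorem rowSymmetrizer_mul_columnAntisymmetrizer_eq_zero {I J : N.Partition} {g : Perm (Fin N)}
    {x y : Fin N} (hxy : x ≠ y) (hrow : boxRow I x = boxRow I y)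
    (hcol : boxCol J (g⁻¹ x) = boxCol J (g⁻¹ y)) :
    rowSymmetrizer I * of ℂ _ g * columnAntisymmetrizer J = 0 := by
  have hconj : swap x y * g = g * swap (g⁻¹ x) (g⁻¹ y) := by
    exact swap_mul_eq_mul_swap _ _ _
  have h1 : rowSymmetrizer I * of ℂ _ g * columnAntisymmetrizer J =
      -(rowSymmetrizer I * of ℂ _ g * columnAntisymmetrizer J) := by
    conv_lhs => rw [← rowSymmetrizer_mul (swap_mem_rowGroup hrow), mul_assoc (rowSymmetrizer I),
      ← map_mul, hconj, map_mul, ← mul_assoc, mul_assoc _ _ (columnAntisymmetrizer J),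
      mul_columnAntisymmetrizer (swap_mem_columnGroup hcol)]
    rw [Perm.sign_swap (by simpa using hxy)]
    simp
  have h2 : (2 : ℂ) • (rowSymmetrizer I * of ℂ _ g * columnAntisymmetrizer J) = 0 := by
    rw [two_smul]
    exact add_eq_zero_iff_eq_neg.2 h1
  exact (smul_eq_zero.1 h2).resolve_left two_ne_zero

open Finset in
/-- A non-zero product `a_I g b_J` forces `I` to be dominated by `J`. -/
theorem card_boxRow_lt_le_of_ne_zero {I J : N.Partition} {g : Perm (Fin N)}
    (h : rowSymmetrizer I * of ℂ _ g * columnAntisymmetrizer J ≠ 0) (r : ℕ) :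
    #{x | boxRow I x < r} ≤ #{x | boxRow J x < r} := by
  refine card_rows_le (col := boxCol J) g⁻¹ (exists_box_above J) (fun x y h1 h2 => ?_) r
  by_contra hxy
  exact h (rowSymmetrizer_mul_columnAntisymmetrizer_eq_zero hxy h1 h2)

/-- A non-zero product `a_I g b_I` forces `g = p q` with `p` in the row group and `q` in the column
group. -/
theorem exists_eq_mul_of_ne_zero {I : N.Partition} {g : Perm (Fin N)}
    (h : rowSymmetrizer I * of ℂ _ g * columnAntisymmetrizer I ≠ 0) :
    ∃ p ∈ rowGroup I, ∃ q ∈ columnGroup I, g = p * q := by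
  have hu : ∀ x y, boxRow I x = boxRow I y → boxCol I (g⁻¹ x) = boxCol I (g⁻¹ y) → x = y := by
    intro x y h1 h2
    by_contra hxy
    exact h (rowSymmetrizer_mul_columnAntisymmetrizer_eq_zero hxy h1 h2)
  choose f hf hf' using exists_box_of_row_col (row := boxRow I) (col := boxCol I) g⁻¹
    (exists_box_above I) hu
  have hinj : Function.Injective f := by
    intro x y hxy
    exact hu x y (by rw [← hf x, ← hf y, hxy]) (by rw [← hf' x, ← hf' y, hxy])
  let p : Perm (Fin N) := Equiv.ofBijective f (Finite.injective_iff_bijective.1 hinj)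
  have hp : p ∈ rowGroup I := mem_rowGroup.2 hf
  refine ⟨p⁻¹, inv_mem_rowGroup hp, p * g, mem_columnGroup.2 fun x => ?_, by simp⟩
  exact (hf' (g x)).trans (congrArg _ (g.symm_apply_apply x))

/-- By linearity, what is to be shown for `a_I x b_J` has to be shown for permutations `x` only. -/
theorem sandwich_induction {I J : N.Partition} {P : MonoidAlgebra ℂ (Perm (Fin N)) → Prop}
    (hadd : ∀ x y, P x → P y → P (x + y)) (hsmul : ∀ (c : ℂ) x, P x → P (c • x))
    (h : ∀ g, P (rowSymmetrizer I * of ℂ _ g * columnAntisymmetrizer J))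
    (x : MonoidAlgebra ℂ (Perm (Fin N))) :
    P (rowSymmetrizer I * x * columnAntisymmetrizer J) := by
  induction x using MonoidAlgebra.induction_on with
  | of g => exact h g
  | add x y hx hy => rw [mul_add, add_mul]; exact hadd _ _ hx hy
  | smul c x hx => rw [mul_smul_comm, smul_mul_assoc]; exact hsmul _ _ hx

/-- The products `a_I g b_I` with a permutation `g` are `0` or, since `g = p q`, equal to `± c_I`. -/
theorem exists_rowSymmetrizer_mul_eq_smul (I : N.Partition)
    (x : MonoidAlgebra ℂ (Perm (Fin N))) :
    ∃ k : ℂ, rowSymmetrizer I * x * columnAntisymmetrizer I = k • youngSymmetrizer I := by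
  refine sandwich_induction (P := fun z => ∃ k : ℂ, z = k • youngSymmetrizer I)
    ?_ ?_ ?_ x
  · rintro _ _ ⟨k, rfl⟩ ⟨l, rfl⟩
    exact ⟨k + l, (add_smul _ _ _).symm⟩
  · rintro c _ ⟨k, rfl⟩
    exact ⟨c * k, smul_smul _ _ _⟩
  · intro g
    by_cases h : rowSymmetrizer I * of ℂ _ g * columnAntisymmetrizer I = 0
    · exact ⟨0, by rw [h, zero_smul]⟩
    · obtain ⟨p, hp, q, hq, rfl⟩ := exists_eq_mul_of_ne_zero h
      refine ⟨((Perm.sign q : ℤ) : ℂ), ?_⟩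
      rw [map_mul, ← mul_assoc, rowSymmetrizer_mul hp, mul_assoc, mul_columnAntisymmetrizer hq,
        mul_smul_comm, youngSymmetrizer_eq]

theorem exists_youngSymmetrizer_mul_eq_smul (I : N.Partition)
    (x : MonoidAlgebra ℂ (Perm (Fin N))) :
    ∃ k : ℂ, youngSymmetrizer I * x * youngSymmetrizer I = k • youngSymmetrizer I := by
  obtain ⟨k, hk⟩ := exists_rowSymmetrizer_mul_eq_smul I
    (columnAntisymmetrizer I * x * rowSymmetrizer I)
  exact ⟨k, by rw [← hk]; simp only [youngSymmetrizer_eq, mul_assoc]⟩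

theorem eq_one_of_mem_of_mem {I : N.Partition} {g : Perm (Fin N)} (h : g ∈ rowGroup I)
    (h' : g ∈ columnGroup I) : g = 1 :=
  Equiv.ext fun x => box_injective I (mem_rowGroup.1 h x) (mem_columnGroup.1 h' x)

theorem one_mem_rowGroup (I : N.Partition) : 1 ∈ rowGroup I := by simp [mem_rowGroup]

theorem one_mem_columnGroup (I : N.Partition) : 1 ∈ columnGroup I := by simp [mem_columnGroup]

theorem coeff_one_youngSymmetrizer (I : N.Partition) : (youngSymmetrizer I).coeff 1 = 1 := by
  have h : ∀ p ∈ rowGroup I, ∀ q ∈ columnGroup I,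
      (of ℂ _ p * ((Perm.sign q : ℤ) : ℂ) • of ℂ (Perm (Fin N)) q).coeff 1 =
        if p = 1 then (if q = 1 then 1 else 0) else 0 := by
    intro p hp q hq
    rw [mul_smul_comm, ← map_mul]
    simp only [of_apply, coeff_smul_apply, coeff_single, Finsupp.single_apply]
    by_cases hpq : p * q = 1
    · have hp1 : p = 1 := by
        refine eq_one_of_mem_of_mem hp ?_
        rw [mul_eq_one_iff_eq_inv.1 hpq]
        exact inv_mem_columnGroup hq
      subst hp1
      obtain rfl : q = 1 := by simpa using hpq
      simp
    · rw [if_neg hpq, smul_zero]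
      split_ifs with h1 h2
      · exact absurd (by simp [h1, h2]) hpq
      · rfl
      · rfl
  rw [youngSymmetrizer, Finset.sum_mul_sum]
  simp only [coeff_sum, Finsupp.finsetSum_apply]
  rw [Finset.sum_congr rfl fun p hp => Finset.sum_congr rfl (h p hp)]
  simp [one_mem_rowGroup, one_mem_columnGroup]

end YoungSymmetrizer

/-! ### The Specht modules are irreducible and pairwise inequivalent -/

section Specht

open Equiv MonoidAlgebra

variable {N : ℕ}

theorem coe_spechtRep_apply (I : N.Partition) (σ : Perm (Fin N)) (x : spechtModule I) :
    (spechtRep I σ x : MonoidAlgebra ℂ (Perm (Fin N))) = of ℂ _ σ * x := rfl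

theorem youngSymmetrizer_ne_zero (I : N.Partition) : youngSymmetrizer I ≠ 0 := by
  intro h
  have := coeff_one_youngSymmetrizer I
  simp [h] at this

theorem youngSymmetrizer_mem (I : N.Partition) : youngSymmetrizer I ∈ spechtModule I :=
  ⟨1, by simp⟩

/-- A left ideal with zero square vanishes, since the group algebra is semisimple. -/
theorem left_ideal_eq_bot_of_mul_eq_zero
    (U : Submodule (MonoidAlgebra ℂ (Perm (Fin N))) (MonoidAlgebra ℂ (Perm (Fin N))))
    (h : ∀ u ∈ U, ∀ w ∈ U, w * u = 0) : U = ⊥ := by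
  obtain ⟨e, he, hU⟩ := IsSemisimpleRing.ideal_eq_span_idempotent U
  have heU : e ∈ U := by rw [hU]; exact Submodule.mem_span_singleton_self e
  rw [hU, ← he.eq, h e heU e heU]
  simp

/-- A subrepresentation of the Specht module, as a left ideal of the group algebra. -/
def Subrepresentation.leftIdeal {I : N.Partition} (U : Subrepresentation (spechtRep I)) :
    Submodule (MonoidAlgebra ℂ (Perm (Fin N))) (MonoidAlgebra ℂ (Perm (Fin N))) where
  carrier := {a | ∃ u ∈ U, (u : MonoidAlgebra ℂ (Perm (Fin N))) = a}
  zero_mem' := ⟨0, U.toSubmodule.zero_mem, rfl⟩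
  add_mem' := by
    rintro _ _ ⟨u, hu, rfl⟩ ⟨v, hv, rfl⟩
    exact ⟨u + v, U.toSubmodule.add_mem hu hv, rfl⟩
  smul_mem' := by
    rintro a _ ⟨u, hu, rfl⟩
    induction a using MonoidAlgebra.induction_on with
    | of g => exact ⟨spechtRep I g u, U.apply_mem_toSubmodule g hu, rfl⟩
    | add x y hx hy =>
      obtain ⟨v, hv, hv'⟩ := hx
      obtain ⟨w, hw, hw'⟩ := hy
      exact ⟨v + w, U.toSubmodule.add_mem hv hw, by
        rw [add_smul, ← hv', ← hw']; rfl⟩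
    | smul c x hx =>
      obtain ⟨v, hv, hv'⟩ := hx
      exact ⟨c • v, U.toSubmodule.smul_mem c hv, by rw [smul_assoc, ← hv']; rfl⟩

/-- A subrepresentation `U` that contains the Young symmetrizer `c` is everything. Otherwise
`c U = 0`, so that `U U = 0`, and `U = 0` by semisimplicity. -/
theorem spechtRep_isIrreducible (I : N.Partition) : (spechtRep I).IsIrreducible := by
  have hne : (⊥ : Subrepresentation (spechtRep I)) ≠ ⊤ := by
    intro h
    have h1 : (⟨_, youngSymmetrizer_mem I⟩ : spechtModule I) ∈
        (⊤ : Subrepresentation (spechtRep I)) := Submodule.mem_top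
    rw [← h] at h1
    exact youngSymmetrizer_ne_zero I (congrArg Subtype.val ((Submodule.mem_bot ℂ).1 h1))
  refine { exists_pair_ne := ⟨_, _, hne⟩, eq_bot_or_eq_top := fun U => ?_ }
  by_cases h : youngSymmetrizer I ∈ U.leftIdeal
  · right
    apply Subrepresentation.toSubmodule_injective
    refine (Submodule.eq_top_iff').2 ?_
    rintro ⟨_, y, rfl⟩
    obtain ⟨u, hu, hu'⟩ := U.leftIdeal.smul_mem y h
    have h1 : (⟨_, LinearMap.mem_range_self _ y⟩ : spechtModule I) = u := Subtype.ext hu'.symm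
    exact h1 ▸ hu
  · left
    -- The Young symmetrizer annihilates `U`: otherwise a multiple of it lies in `U`.
    have hzero : ∀ u ∈ U.leftIdeal, youngSymmetrizer I * u = 0 := by
      intro u hu
      obtain ⟨⟨_, y, rfl⟩, hy, hyu⟩ := hu
      obtain ⟨k, hk⟩ := exists_youngSymmetrizer_mul_eq_smul I y
      have hyu' : u = y * youngSymmetrizer I := hyu.symm
      by_contra hne
      rw [hyu', ← mul_assoc, hk] at hne
      have hk0 : k ≠ 0 := fun h0 => hne (by rw [h0, zero_smul])
      apply h
      have h1 : youngSymmetrizer I * u ∈ U.leftIdeal :=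
        U.leftIdeal.smul_mem (youngSymmetrizer I) ⟨_, hy, hyu⟩
      rw [hyu', ← mul_assoc, hk] at h1
      have h2 := U.leftIdeal.smul_mem (algebraMap ℂ _ k⁻¹) h1
      rwa [smul_eq_mul, ← Algebra.smul_def, smul_smul, inv_mul_cancel₀ hk0, one_smul] at h2
    have hbot := left_ideal_eq_bot_of_mul_eq_zero U.leftIdeal (by
      rintro u hu _ ⟨⟨_, y, rfl⟩, -, rfl⟩
      exact (mul_assoc y _ u).trans (by rw [hzero u hu, mul_zero]))
    apply Subrepresentation.toSubmodule_injective
    refine (Submodule.eq_bot_iff _).2 fun u hu => ?_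
    have h1 : (u : MonoidAlgebra ℂ (Perm (Fin N))) ∈ U.leftIdeal := ⟨u, hu, rfl⟩
    rw [hbot] at h1
    exact Subtype.ext ((Submodule.mem_bot _).1 h1)

/-- The left ideal generated by the Young symmetrizer does not have zero square. -/
theorem exists_youngSymmetrizer_mul_ne_zero (I : N.Partition) :
    ∃ (x : MonoidAlgebra ℂ (Perm (Fin N))) (k : ℂ), k ≠ 0 ∧
      youngSymmetrizer I * x * youngSymmetrizer I = k • youngSymmetrizer I := by
  by_contra! h
  have hzero : ∀ x, youngSymmetrizer I * x * youngSymmetrizer I = 0 := by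
    intro x
    obtain ⟨k, hk⟩ := exists_youngSymmetrizer_mul_eq_smul I x
    by_cases hk0 : k = 0
    · rw [hk, hk0, zero_smul]
    · exact absurd hk (h x k hk0)
  have hbot := left_ideal_eq_bot_of_mul_eq_zero
    (Submodule.span (MonoidAlgebra ℂ (Perm (Fin N))) {youngSymmetrizer I}) (by
      intro u hu w hw
      obtain ⟨x, rfl⟩ := Submodule.mem_span_singleton.1 hu
      obtain ⟨y, rfl⟩ := Submodule.mem_span_singleton.1 hw
      simp only [smul_eq_mul]
      rw [mul_assoc, ← mul_assoc _ x, hzero, mul_zero])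
  exact youngSymmetrizer_ne_zero I (Submodule.span_singleton_eq_bot.1 hbot)

/-- An equivariant map between Specht modules commutes with the action of the group algebra. -/
theorem specht_map_mul {I J : N.Partition} (φ : (spechtRep I).Equiv (spechtRep J))
    (a : MonoidAlgebra ℂ (Perm (Fin N))) (x z : spechtModule I)
    (hz : (z : MonoidAlgebra ℂ (Perm (Fin N))) = a * x) :
    (φ z : MonoidAlgebra ℂ (Perm (Fin N))) = a * φ x := by
  induction a using MonoidAlgebra.induction_on generalizing z with
  | of g =>
    obtain rfl : z = spechtRep I g x := Subtype.ext hz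
    exact congrArg Subtype.val
      (Representation.IntertwiningMap.isIntertwining _ _ φ.toIntertwiningMap g x)
  | add a b ha hb =>
    let za : spechtModule I := ⟨a * x, mul_mem_spechtModule I a x x.2⟩
    let zb : spechtModule I := ⟨b * x, mul_mem_spechtModule I b x x.2⟩
    obtain rfl : z = za + zb := Subtype.ext (hz.trans (add_mul _ _ _))
    rw [map_add, Submodule.coe_add, ha za rfl, hb zb rfl, add_mul]
  | smul c a ha =>
    let za : spechtModule I := ⟨a * x, mul_mem_spechtModule I a x x.2⟩
    obtain rfl : z = c • za := Subtype.ext (hz.trans (smul_mul_assoc _ _ _))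
    rw [map_smul, Submodule.coe_smul, ha za rfl, smul_mul_assoc]

open Finset in
/-- If `I` is not dominated by `J` then `c_I x` annihilates the Specht module of `J` for all `x`,
but not the one of `I`. -/
theorem card_boxRow_lt_le_of_equiv {I J : N.Partition} (φ : (spechtRep I).Equiv (spechtRep J))
    (r : ℕ) : #{x | boxRow I x < r} ≤ #{x | boxRow J x < r} := by
  by_contra hr
  obtain ⟨x, k, hk, hx⟩ := exists_youngSymmetrizer_mul_ne_zero I
  let c : spechtModule I := ⟨_, youngSymmetrizer_mem I⟩
  have hc : c ≠ 0 := fun h => youngSymmetrizer_ne_zero I (congrArg Subtype.val h)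
  have hzero : ∀ y, rowSymmetrizer I * y * columnAntisymmetrizer J = 0 := by
    intro y
    refine sandwich_induction (P := fun z => z = 0) ?_ ?_ (fun g => ?_) y
    · rintro _ _ rfl rfl
      exact add_zero _
    · rintro c _ rfl
      exact smul_zero _
    · by_contra hne
      exact hr (card_boxRow_lt_le_of_ne_zero hne r)
  have h1 : (φ (k • c) : MonoidAlgebra ℂ (Perm (Fin N))) = youngSymmetrizer I * x * φ c :=
    specht_map_mul φ _ c _ hx.symm
  obtain ⟨y, hy⟩ : (φ c : MonoidAlgebra ℂ (Perm (Fin N))) ∈ spechtModule J := (φ c).2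
  have h2 : youngSymmetrizer I * x * (φ c : MonoidAlgebra ℂ (Perm (Fin N))) = 0 := by
    rw [← hy, LinearMap.mulRight_apply, youngSymmetrizer_eq, youngSymmetrizer_eq]
    have := hzero (columnAntisymmetrizer I * x * y * rowSymmetrizer J)
    simpa only [mul_assoc] using this
  have h3 : φ (k • c) = 0 := Subtype.ext (h1.trans h2)
  have h4 : k • c = 0 := φ.toLinearEquiv.map_eq_zero_iff.1 h3
  exact hc ((smul_eq_zero.1 h4).resolve_left hk)

theorem eq_of_spechtRep_equiv {I J : N.Partition}
    (h : Nonempty ((spechtRep I).Equiv (spechtRep J))) : I = J := by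
  obtain ⟨φ⟩ := h
  exact partition_ext_of_card fun r => le_antisymm (card_boxRow_lt_le_of_equiv φ r)
    (card_boxRow_lt_le_of_equiv φ.symm r)

/-! ### The Specht modules on which permutations act by the identity or by the sign -/

/-- If permutations act on the Specht module by scalars, these are the coefficients of the Young
symmetrizer. -/
theorem coeff_youngSymmetrizer_of_scalar {I : N.Partition} {ε : Perm (Fin N) → ℂ}
    (h : ∀ σ x, spechtRep I σ x = ε σ • x) (σ : Perm (Fin N)) :
    (youngSymmetrizer I).coeff σ⁻¹ = ε σ := by
  have h1 := congrArg (fun y => y.coeff 1)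
    (congrArg Subtype.val (h σ ⟨_, youngSymmetrizer_mem I⟩))
  simp only [coe_spechtRep_apply, Submodule.coe_smul, coeff_smul_apply,
    coeff_one_youngSymmetrizer, of_apply, coeff_single_mul_apply] at h1
  simpa using h1

/-- With two rows there would be a transposition in the column group. The Young symmetrizer changes
its sign when multiplied by it on the right, but here all its coefficients are `1`. -/
theorem eq_indiscrete_of_trivial {I : N.Partition} (h : ∀ σ x, spechtRep I σ x = x) :
    I = Nat.Partition.indiscrete N := by
  have hlen : (rowLengths I).length ≤ 1 := by
    by_contra! hlen
    have h0 : 0 < (rowLengths I)[0]'(by omega) :=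
      I.parts_pos (mem_rowLengths.1 (List.getElem_mem _))
    have h1 : 0 < (rowLengths I)[1]'(by omega) :=
      I.parts_pos (mem_rowLengths.1 (List.getElem_mem _))
    obtain ⟨x, hx, hx'⟩ := exists_box I 0 0 (by omega) h0
    obtain ⟨y, hy, hy'⟩ := exists_box I 1 0 (by omega) h1
    have hxy : x ≠ y := by
      rintro rfl
      omega
    have h2 := coeff_youngSymmetrizer_of_scalar (ε := fun _ => 1) (by simpa using h) (swap x y)
    have h3 : youngSymmetrizer I * of ℂ _ (swap x y) = -youngSymmetrizer I := by
      rw [youngSymmetrizer_eq, mul_assoc,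
        columnAntisymmetrizer_mul (swap_mem_columnGroup (hx'.trans hy'.symm)), Perm.sign_swap hxy]
      simp
    have h4 := congrArg (fun z => z.coeff 1) h3
    simp [coeff_one_youngSymmetrizer] at h4 h2
    rw [h2] at h4
    norm_num at h4
  have hcard : I.parts.card ≤ 1 := by
    rwa [rowLengths, Multiset.length_sort] at hlen
  apply Nat.Partition.ext
  obtain h0 | ⟨a, ha⟩ : I.parts = 0 ∨ ∃ a, I.parts = {a} := by
    obtain h' | h' : I.parts.card = 0 ∨ I.parts.card = 1 := by omega
    · exact Or.inl (Multiset.card_eq_zero.1 h')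
    · exact Or.inr (Multiset.card_eq_one.1 h')
  · have hN : N = 0 := by rw [← I.parts_sum, h0]; rfl
    subst hN
    rw [h0]
    simp
  · have hN : a = N := by rw [← I.parts_sum, ha]; simp
    subst hN
    have : 0 < a := I.parts_pos (by rw [ha]; simp)
    rw [ha, Nat.Partition.indiscrete_parts this.ne']

/-- With two columns there would be a transposition in the row group. It fixes the Young symmetrizer
when multiplied to it on the left, but here it has to change its sign. -/
theorem eq_onesPartition_of_sign {I : N.Partition}
    (h : ∀ σ x, spechtRep I σ x = ((Perm.sign σ : ℤ) : ℂ) • x) :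
    I = onesPartition N := by
  have hone : ∀ n ∈ I.parts, n = 1 := by
    intro n hn
    have hpos : 0 < n := I.parts_pos hn
    by_contra hne
    obtain ⟨i, hi, rfl⟩ := List.getElem_of_mem (mem_rowLengths.2 hn)
    obtain ⟨x, hx, hx'⟩ := exists_box I i 0 hi (by omega)
    obtain ⟨y, hy, hy'⟩ := exists_box I i 1 hi (by omega)
    have hxy : x ≠ y := by
      rintro rfl
      omega
    have h2 := coeff_youngSymmetrizer_of_scalar h (swap x y)
    have h3 : of ℂ _ (swap x y) * youngSymmetrizer I = youngSymmetrizer I := by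
      rw [youngSymmetrizer_eq, ← mul_assoc, mul_rowSymmetrizer
        (swap_mem_rowGroup (hx.trans hy.symm))]
    have h4 := congrArg (fun z => z.coeff 1) h3
    rw [Perm.sign_swap hxy] at h2
    simp [coeff_one_youngSymmetrizer] at h4 h2
    rw [h2] at h4
    norm_num at h4
  have hparts : I.parts = Multiset.replicate N 1 := by
    rw [Multiset.eq_replicate_card.2 hone]
    congr 1
    have := I.parts_sum
    rw [Multiset.eq_replicate_card.2 hone] at this
    simpa using this
  apply Nat.Partition.ext
  rw [hparts, onesPartition, Nat.Partition.ofSums_parts]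
  symm
  rw [Multiset.filter_eq_self]
  intro a ha
  rw [Multiset.eq_of_mem_replicate ha]
  exact one_ne_zero

end Specht

/-! ### Every representation of the symmetric group is a sum of Specht modules -/

section Irreducible

open Equiv MonoidAlgebra Representation

variable {N : ℕ}

instance (I : N.Partition) : (spechtRep I).IsIrreducible := spechtRep_isIrreducible I

/-- Pairwise inequivalent irreducible representations have linearly independent characters. -/
theorem linearIndependent_character {G ι : Type*} [Group G] [Fintype G] [Fintype ι]
    {M : ι → Type*} [∀ i, AddCommGroup (M i)] [∀ i, Module ℂ (M i)]
    [∀ i, FiniteDimensional ℂ (M i)] (ρ : ∀ i, Representation ℂ G (M i))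
    [∀ i, (ρ i).IsIrreducible] (h : ∀ i j, Nonempty ((ρ i).Equiv (ρ j)) → i = j) :
    LinearIndependent ℂ fun i => (ρ i).character := by
  classical
  have hcard : (Nat.card G : ℂ) ≠ 0 := by simp
  let := invertibleOfNonzero hcard
  rw [Fintype.linearIndependent_iff]
  intro c hc j
  have h1 : (Nat.card G : ℂ)⁻¹ * ∑ g : G, (∑ i, c i • (ρ i).character) g *
      (ρ j).character g⁻¹ = c j := by
    calc _ = ∑ i, c i * ((Nat.card G : ℂ)⁻¹ * ∑ g : G, (ρ i).character g *
          (ρ j).character g⁻¹) := by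
          simp only [Finset.sum_apply, Pi.smul_apply, smul_eq_mul, Finset.sum_mul, Finset.mul_sum]
          rw [Finset.sum_comm]
          refine Finset.sum_congr rfl fun i _ => Finset.sum_congr rfl fun g _ => by ring
      _ = ∑ i, c i * (if i = j then 1 else 0) := by
          refine Finset.sum_congr rfl fun i _ => ?_
          rw [char_orthonormal]
          congr 1
          refine if_congr ⟨fun hij => (h j i hij).symm, ?_⟩ rfl rfl
          rintro rfl
          exact ⟨Representation.Equiv.refl _⟩
      _ = c j := by simp
  rw [← h1, hc]
  simp

theorem linearIndependent_simpleCharacter :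
    LinearIndependent ℂ (simpleCharacter : N.Partition → Perm (Fin N) → ℂ) :=
  linearIndependent_character (fun I => spechtRep I) fun _ _ h => eq_of_spechtRep_equiv h

theorem character_eq_of_partition_eq {M : Type*} [AddCommGroup M] [Module ℂ M]
    (ρ : Representation ℂ (Perm (Fin N)) M) {σ τ : Perm (Fin N)}
    (h : σ.partition = τ.partition) : ρ.character σ = ρ.character τ := by
  obtain ⟨g, rfl⟩ := isConj_iff.1 (Perm.partition_eq_of_isConj.2 h)
  exact (char_conj ρ σ g).symm

/-- The characters are functions of the cycle type, so there are at most as many inequivalent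
irreducible representations as there are partitions. -/
theorem exists_equiv_spechtRep {M : Type*} [AddCommGroup M] [Module ℂ M] [FiniteDimensional ℂ M]
    (ρ : Representation ℂ (Perm (Fin N)) M) [ρ.IsIrreducible] :
    ∃ I, Nonempty ((spechtRep I).Equiv ρ) := by
  classical
  by_contra! hne
  let χ : Option N.Partition → Perm (Fin N) → ℂ := fun i => i.elim ρ.character simpleCharacter
  have hχ : LinearIndependent ℂ χ := by
    rw [linearIndependent_option]
    refine ⟨linearIndependent_simpleCharacter, fun hmem => ?_⟩
    have hcard : (Nat.card (Perm (Fin N)) : ℂ) ≠ 0 := by simp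
    let := invertibleOfNonzero hcard
    obtain ⟨c, hc⟩ := (Submodule.mem_span_range_iff_exists_fun ℂ).1 hmem
    have h1 := char_orthonormal ρ ρ
    rw [if_pos ⟨Representation.Equiv.refl ρ⟩] at h1
    have h2 : ∀ I, (Nat.card (Perm (Fin N)) : ℂ)⁻¹ * ∑ g, simpleCharacter I g *
        ρ.character g⁻¹ = 0 := by
      intro I
      have := char_orthonormal (spechtRep I) ρ
      rw [if_neg fun ⟨φ⟩ => (hne I).false φ.symm] at this
      exact this
    have h3 : (Nat.card (Perm (Fin N)) : ℂ)⁻¹ * ∑ g, ρ.character g * ρ.character g⁻¹ =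
        ∑ I, c I * ((Nat.card (Perm (Fin N)) : ℂ)⁻¹ * ∑ g, simpleCharacter I g *
          ρ.character g⁻¹) := by
      have hc' : ∀ g, ρ.character g = ∑ I, c I * simpleCharacter I g := by
        intro g
        rw [← show _ = ρ.character g from congrFun hc g]
        simp [χ]
      simp only [Finset.mul_sum]
      rw [Finset.sum_comm]
      refine Finset.sum_congr rfl fun g _ => ?_
      nth_rw 1 [hc' g]
      rw [Finset.sum_mul, Finset.mul_sum]
      exact Finset.sum_congr rfl fun I _ => by ring
    simp only [h2, mul_zero, Finset.sum_const_zero] at h3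
    exact one_ne_zero (h1.symm.trans h3)
  let L : ((Fintype.card (Fin N)).Partition → ℂ) →ₗ[ℂ] (Perm (Fin N) → ℂ) :=
    LinearMap.funLeft ℂ ℂ Perm.partition
  have hL : ∀ i, ∃ F, L F = χ i := by
    have key : ∀ f : Perm (Fin N) → ℂ,
        (∀ σ τ : Perm (Fin N), σ.partition = τ.partition → f σ = f τ) → ∃ F, L F = f := by
      intro f hf
      have hfac : Function.FactorsThrough f (Perm.partition (α := Fin N)) :=
        fun σ τ hστ => hf σ τ hστ
      exact ⟨Function.extend Perm.partition f 0, funext fun σ => hfac.extend_apply 0 σ⟩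
    intro i
    refine key _ fun σ τ h => ?_
    cases i with
    | none => exact character_eq_of_partition_eq ρ h
    | some I => exact character_eq_of_partition_eq (spechtRep I) h
  choose F hF using hL
  have hFli : LinearIndependent ℂ F := by
    refine LinearIndependent.of_comp L ?_
    convert hχ
    exact funext hF
  have hle := hFli.fintype_card_le_finrank
  rw [Module.finrank_fintype_fun_eq_card, Fintype.card_option,
    congrArg (fun n => Fintype.card n.Partition) (Fintype.card_fin N)] at hle
  omega

end Irreducible

section Decomposition

open MonoidAlgebra Representation

variable {N : ℕ}

/-- Every simple submodule of a representation is a copy of a Specht module. -/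
theorem exists_specht_linearEquiv {W : Type*} [AddCommGroup W] [Module ℂ W]
    [FiniteDimensional ℂ W] (ρ : Representation ℂ (Equiv.Perm (Fin N)) W)
    (S : Submodule (MonoidAlgebra ℂ (Equiv.Perm (Fin N))) ρ.asModule)
    [IsSimpleModule (MonoidAlgebra ℂ (Equiv.Perm (Fin N))) S] :
    ∃ (I : N.Partition) (f : spechtModule I ≃ₗ[ℂ] S),
      ∀ σ x, f (spechtRep I σ x) = of ℂ (Equiv.Perm (Fin N)) σ • f x := by
  have : Module.Finite ℂ S := Module.Finite.of_injective
    (S.subtype.restrictScalars ℂ) S.injective_subtype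
  let ρS : Representation ℂ (Equiv.Perm (Fin N)) S := Representation.ofModule' S
  let e : ρS.asModule ≃ₗ[MonoidAlgebra ℂ (Equiv.Perm (Fin N))] S :=
    { ρS.asModuleEquiv with
      map_smul' := fun a x => by
        refine (asModuleEquiv_map_smul ρS a x).trans ?_
        have h : ρS.asAlgebraHom = Algebra.lsmul ℂ ℂ S :=
          (MonoidAlgebra.lift ℂ (S →ₗ[ℂ] S) (Equiv.Perm (Fin N))).apply_symm_apply _
        rw [h]
        rfl }
  have : ρS.IsIrreducible :=
    (irreducible_iff_isSimpleModule_asModule ρS).2 (IsSimpleModule.congr e)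
  obtain ⟨I, ⟨φ⟩⟩ := exists_equiv_spechtRep ρS
  refine ⟨I, φ.toLinearEquiv, fun σ x => ?_⟩
  exact Representation.IntertwiningMap.isIntertwining _ _ φ.toIntertwiningMap σ x

/-- A finite-dimensional representation of `S_N` has a basis in which the permutations act by the
matrices `⨁_I [D^I]^{⊕ C_I}`. -/
theorem exists_basis_permutationPhase {W : Type*} [AddCommGroup W] [Module ℂ W]
    [FiniteDimensional ℂ W] (ρ : Representation ℂ (Equiv.Perm (Fin N)) W) :
    ∃ (C : N.Partition → ℕ) (Φ : Module.Basis (PhaseIndex C) ℂ W),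
      ∀ σ j, ρ σ (Φ j) = ∑ j', permutationPhase C σ j' j • Φ j' := by
  classical
  have : Module.Finite (MonoidAlgebra ℂ (Equiv.Perm (Fin N))) ρ.asModule :=
    Module.Finite.of_restrictScalars_finite ℂ _ _
  obtain ⟨n, S, e, hS⟩ := IsSemisimpleModule.exists_linearEquiv_fin_dfinsupp
    (MonoidAlgebra ℂ (Equiv.Perm (Fin N))) ρ.asModule
  choose g f hf using fun i => have := hS i; exists_specht_linearEquiv ρ (S i)
  -- The multiplicity of `D^I` is the number of the simple summands that are copies of it.
  let C : N.Partition → ℕ := fun I => Fintype.card {i // g i = I}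
  let θ : (Σ I, Fin (C I)) ≃ Fin n :=
    (Equiv.sigmaCongrRight fun I => (Fintype.equivFin {i // g i = I}).symm).trans
      (Equiv.sigmaFiberEquiv g)
  have hθ : ∀ p, g (θ p) = p.1 := fun p =>
    ((Fintype.equivFin {i // g i = p.1}).symm p.2).2
  have hex : ∀ p : (Σ I, Fin (C I)), ∃ f : spechtModule p.1 ≃ₗ[ℂ] S (θ p),
      ∀ σ x, f (spechtRep p.1 σ x) = of ℂ (Equiv.Perm (Fin N)) σ • f x := by
    intro p
    rw [← hθ p]
    exact ⟨f (θ p), hf (θ p)⟩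
  choose φ hφ using hex
  let R₀ : W →ₗ[ℂ] (p : (Σ I, Fin (C I))) → spechtModule p.1 :=
    LinearMap.pi fun p => (φ p).symm.toLinearMap ∘ₗ
      (DFinsupp.lapply (R := MonoidAlgebra ℂ (Equiv.Perm (Fin N))) (θ p)
        ∘ₗ e.toLinearMap).restrictScalars ℂ ∘ₗ ρ.asModuleEquiv.symm.toLinearMap
  have hR₀ : ∀ w p, R₀ w p = (φ p).symm (e (ρ.asModuleEquiv.symm w) (θ p)) := fun _ _ => rfl
  have hbij : Function.Bijective R₀ := by
    constructor
    · intro v w hvw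
      apply ρ.asModuleEquiv.symm.injective
      apply e.injective
      refine DFinsupp.ext fun i => ?_
      obtain ⟨p, rfl⟩ := θ.surjective i
      have := congrFun hvw p
      rw [hR₀, hR₀] at this
      exact (φ p).symm.injective this
    · intro y
      let z := Equiv.piCongrLeft (fun i => S i) θ fun p => φ p (y p)
      refine ⟨ρ.asModuleEquiv (e.symm (DFinsupp.equivFunOnFintype.symm z)), funext fun p => ?_⟩
      rw [hR₀, LinearEquiv.symm_apply_apply, LinearEquiv.apply_symm_apply,
        LinearEquiv.symm_apply_eq]
      exact Equiv.piCongrLeft_apply_apply (fun i => S i) θ (fun p => φ p (y p)) p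
  have hequiv : ∀ σ w p, R₀ (ρ σ w) p = spechtRep p.1 σ (R₀ w p) := by
    intro σ w p
    apply (φ p).injective
    rw [hφ, hR₀, hR₀, LinearEquiv.apply_symm_apply, LinearEquiv.apply_symm_apply,
      asModuleEquiv_symm_map_rho, map_smul]
    rfl
  let R := LinearEquiv.ofBijective R₀ hbij
  let b := (Pi.basis fun p : (Σ I, Fin (C I)) => Module.finBasis ℂ (spechtModule p.1)).map R.symm
  let ι : (Σ p : (Σ I, Fin (C I)), Fin (Module.finrank ℂ (spechtModule p.1))) ≃ PhaseIndex C :=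
    { toFun := fun q => ⟨q.1.1, q.2, q.1.2⟩
      invFun := fun j => ⟨⟨j.1, j.2.2⟩, j.2.1⟩
      left_inv := fun _ => rfl
      right_inv := fun _ => rfl }
  have hb : ∀ I a c, R (b.reindex ι ⟨I, a, c⟩) =
      Pi.single ⟨I, c⟩ (Module.finBasis ℂ (spechtModule I) a) := by
    intro I a c
    rw [Module.Basis.reindex_apply, Module.Basis.map_apply, LinearEquiv.apply_symm_apply,
      Pi.basis_apply]
    rfl
  refine ⟨C, b.reindex ι, ?_⟩
  rintro σ ⟨I, a, c⟩
  have hmat : spechtRep I σ (Module.finBasis ℂ (spechtModule I) a) =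
      ∑ a', spechtMatrix I σ a' a • Module.finBasis ℂ (spechtModule I) a' := by
    conv_lhs => rw [← (Module.finBasis ℂ (spechtModule I)).sum_repr
      (spechtRep I σ (Module.finBasis ℂ (spechtModule I) a))]
    simp only [spechtMatrix, LinearMap.toMatrix_apply]
  have hl : R (ρ σ (b.reindex ι ⟨I, a, c⟩)) =
      Pi.single ⟨I, c⟩ (spechtRep I σ (Module.finBasis ℂ (spechtModule I) a)) := by
    funext p
    refine (hequiv σ _ p).trans ?_
    have := congrFun (hb I a c) p
    rw [show R₀ (b.reindex ι ⟨I, a, c⟩) p = _ from this]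
    by_cases hp : p = ⟨I, c⟩
    · subst hp
      simp
    · simp [hp]
  apply R.injective
  rw [hl, hmat, map_sum, Fintype.sum_sigma, Finset.sum_eq_single I]
  · rw [Fintype.sum_prod_type]
    have hsum : ∀ s : Fin (Module.finrank ℂ (spechtModule I)) → spechtModule I,
        (Pi.single ⟨I, c⟩ (∑ a', s a') : (p : (Σ I, Fin (C I))) → spechtModule p.1) =
          ∑ a', Pi.single ⟨I, c⟩ (s a') := fun s =>
      map_sum (LinearMap.single ℂ (fun p : (Σ I, Fin (C I)) => spechtModule p.1) ⟨I, c⟩) s _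
    rw [hsum]
    refine Finset.sum_congr rfl fun a' _ => ?_
    rw [Finset.sum_eq_single c]
    · rw [map_smul, hb, permutationPhase, Matrix.blockDiagonal'_apply_eq,
        Matrix.blockDiagonal_apply_eq, Pi.single_smul]
    · intro c' _ hc'
      rw [permutationPhase, Matrix.blockDiagonal'_apply_eq, Matrix.blockDiagonal_apply_ne _ _ _ hc',
        zero_smul, map_zero]
    · simp
  · rintro I' - hI'
    refine Finset.sum_eq_zero fun x _ => ?_
    rw [permutationPhase, Matrix.blockDiagonal'_apply_ne _ _ _ hI', zero_smul, map_zero]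
  · simp

end Decomposition

/-! ### The commutant of the symmetric group on a tensor power -/

section TensorPower

variable {V : Type*} [NormedAddCommGroup V] [InnerProductSpace ℂ V] {N : ℕ}

theorem exchange_tprod (σ : Equiv.Perm (Fin N)) (v : Fin N → V) :
    exchange V N σ (PiTensorProduct.tprod ℂ v) = PiTensorProduct.tprod ℂ fun i => v (σ.symm i) :=
  PiTensorProduct.reindex_tprod (R := ℂ) (s := fun _ : Fin N => V) σ v

theorem exchange_mul_map (σ : Equiv.Perm (Fin N)) (f : Fin N → V →ₗ[ℂ] V) :
    exchange V N σ * PiTensorProduct.map f =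
      PiTensorProduct.map (fun i => f (σ.symm i)) * exchange V N σ := by
  refine PiTensorProduct.ext (MultilinearMap.ext fun v => ?_)
  simp [exchange_tprod, PiTensorProduct.map_tprod]

/-- The operators `f_1 ⊗ … ⊗ f_N` span the operators on `V^{⊗N}`. -/
theorem span_range_map [FiniteDimensional ℂ V] :
    Submodule.span ℂ (Set.range fun f : Fin N → V →ₗ[ℂ] V => PiTensorProduct.map f) = ⊤ := by
  classical
  rw [Submodule.eq_top_iff']
  intro X
  let b := Module.finBasis ℂ V
  let B := Basis.piTensorProduct fun _ : Fin N => b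
  have hX : X = ∑ q, ∑ p, B.repr (X (B q)) p •
      PiTensorProduct.map fun i => (b.coord (q i)).smulRight (b (p i)) := by
    refine B.ext fun r => ?_
    have hmap : ∀ q p : Fin N → Fin (Module.finrank ℂ V),
        PiTensorProduct.map (fun i => (b.coord (q i)).smulRight (b (p i))) (B r) =
          if r = q then B p else 0 := by
      intro q p
      simp only [B, Basis.piTensorProduct_apply, PiTensorProduct.map_tprod,
        LinearMap.smulRight_apply, Module.Basis.coord_apply, Module.Basis.repr_self]
      rw [MultilinearMap.map_smul_univ]
      split_ifs with h
      · subst h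
        simp
      · obtain ⟨i, hi⟩ := Function.ne_iff.1 h
        rw [Finset.prod_eq_zero (Finset.mem_univ i) (by simp [hi]), zero_smul]
    simp only [LinearMap.sum_apply, LinearMap.smul_apply, hmap]
    rw [Finset.sum_eq_single r]
    · simp only [if_true]
      exact (B.sum_repr _).symm
    · intro q _ hq
      simp [Ne.symm hq]
    · simp
  rw [hX]
  exact Submodule.sum_mem _ fun q _ => Submodule.sum_mem _ fun p _ =>
    Submodule.smul_mem _ _ (Submodule.subset_span ⟨_, rfl⟩)

/-- The sum of the operators that have `f_1, …, f_r` at `r` different positions, in all possible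
ways, and the identity at the other positions. -/
def placementSum {r : ℕ} (f : Fin r → V →ₗ[ℂ] V) : Module.End ℂ (NParticle V N) :=
  ∑ e : Fin r ↪ Fin N, PiTensorProduct.map (Function.extend e f fun _ => LinearMap.id)

theorem map_update_mul_map (i : Fin N) (h : V →ₗ[ℂ] V) (f : Fin N → V →ₗ[ℂ] V) :
    (PiTensorProduct.map (Function.update (fun _ => LinearMap.id) i h) :
      Module.End ℂ (NParticle V N)) * PiTensorProduct.map f =
      PiTensorProduct.map (Function.update f i (h ∘ₗ f i)) := by
  rw [Module.End.mul_eq_comp, ← PiTensorProduct.map_comp]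
  congr 1
  funext k
  by_cases hk : k = i
  · subst hk
    simp
  · simp [hk]

/-- In a product with `H_N(h)`, the factor `h` either gets a position of its own or meets one of the
`f_j`. -/
theorem idealHamiltonian_mul_placementSum {r : ℕ} (h : V →ₗ[ℂ] V) (f : Fin r → V →ₗ[ℂ] V) :
    idealHamiltonian N h * placementSum f =
      placementSum (Fin.cons h f : Fin (r + 1) → V →ₗ[ℂ] V) +
        ∑ j, placementSum (Function.update f j (h ∘ₗ f j)) := by
  classical
  have hcons : placementSum (N := N) (Fin.cons h f : Fin (r + 1) → V →ₗ[ℂ] V) =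
      ∑ e : Fin r ↪ Fin N, ∑ i : {i // i ∉ Set.range e}, PiTensorProduct.map
        (Function.update (Function.extend e f fun _ => LinearMap.id) i.1 h) := by
    rw [placementSum, ← Equiv.sum_comp (Equiv.embeddingFinSucc r (Fin N)).symm,
      Fintype.sum_sigma]
    refine Finset.sum_congr rfl fun e _ => Finset.sum_congr rfl fun i _ => ?_
    congr 1
    funext k
    set e' := (Equiv.embeddingFinSucc r (Fin N)).symm ⟨e, i⟩
    have he' : ⇑e' = Fin.cons i.1 e := Equiv.coe_embeddingFinSucc_symm _
    have h0 : e' 0 = i.1 := by rw [he', Fin.cons_zero]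
    have hs : ∀ j : Fin r, e' j.succ = e j := fun j => by rw [he', Fin.cons_succ]
    by_cases hk : k = i.1
    · rw [hk, Function.update_self, ← h0, e'.injective.extend_apply, Fin.cons_zero]
    · rw [Function.update_of_ne hk]
      by_cases hj : ∃ j, e j = k
      · obtain ⟨j, rfl⟩ := hj
        rw [e.injective.extend_apply, ← hs, e'.injective.extend_apply, Fin.cons_succ]
      · rw [Function.extend_apply' _ _ _ hj, Function.extend_apply']
        rintro ⟨l, hl⟩
        induction l using Fin.cases with
        | zero => exact hk (hl.symm.trans h0)
        | succ j => exact hj ⟨j, (hs j).symm.trans hl⟩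
  have hupd : ∑ j, placementSum (N := N) (Function.update f j (h ∘ₗ f j)) =
      ∑ e : Fin r ↪ Fin N, ∑ j, PiTensorProduct.map
        (Function.update (Function.extend e f fun _ => LinearMap.id) (e j) (h ∘ₗ f j)) := by
    simp only [placementSum]
    rw [Finset.sum_comm]
    refine Finset.sum_congr rfl fun e _ => Finset.sum_congr rfl fun j _ => ?_
    congr 1
    funext k
    by_cases hk : ∃ j', e j' = k
    · obtain ⟨j', rfl⟩ := hk
      by_cases hj : j' = j
      · subst hj
        simp [e.injective.extend_apply]
      · simp [e.injective.extend_apply, hj]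
    · have hkj : k ≠ e j := fun h' => hk ⟨j, h'.symm⟩
      rw [Function.extend_apply' _ _ _ hk, Function.update_of_ne hkj,
        Function.extend_apply' _ _ _ hk]
  rw [hcons, hupd, ← Finset.sum_add_distrib, idealHamiltonian, placementSum, Finset.sum_mul_sum,
    Finset.sum_comm]
  refine Finset.sum_congr rfl fun e _ => ?_
  simp only [map_update_mul_map]
  rw [← Fintype.sum_subtype_add_sum_subtype (fun i => i ∉ Set.range e)]
  congr 1
  · refine Finset.sum_congr rfl fun i _ => ?_
    rw [Function.extend_apply' _ _ _ i.2, LinearMap.comp_id]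
  · symm
    refine Fintype.sum_equiv ((Equiv.ofInjective e e.injective).trans
      (Equiv.subtypeEquivRight fun i => not_not.symm)) _ _ fun j => ?_
    simp [e.injective.extend_apply]

/-- By induction on the number of factors: `idealHamiltonian_mul_placementSum` expresses the sums
with `r + 1` factors by products of the Hamiltonians and sums with `r` factors. -/
theorem placementSum_mem {M : Subalgebra ℂ (Module.End ℂ (NParticle V N))}
    (hM : ∀ h : V →ₗ[ℂ] V, idealHamiltonian N h ∈ M) {r : ℕ} (f : Fin r → V →ₗ[ℂ] V) :
    placementSum f ∈ M := by
  induction r with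
  | zero =>
    have : placementSum (N := N) f = 1 := by
      rw [placementSum, Fintype.sum_unique]
      rw [show (Function.extend (default : Fin 0 ↪ Fin N) f fun _ => LinearMap.id) =
        fun _ => LinearMap.id from funext fun k => Function.extend_apply' _ _ _ (by simp)]
      exact PiTensorProduct.map_id
    rw [this]
    exact M.one_mem
  | succ r ih =>
    have h := idealHamiltonian_mul_placementSum (N := N) (f 0) (Fin.tail f)
    rw [Fin.cons_self_tail, ← sub_eq_iff_eq_add] at h
    rw [← h]
    exact M.sub_mem (M.mul_mem (hM _) (ih _)) (M.sum_mem fun j _ => ih _)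

/-- A sum over all permutations of the factors is a `placementSum` with `r = N`. -/
theorem sum_map_comp_perm_mem {M : Subalgebra ℂ (Module.End ℂ (NParticle V N))}
    (hM : ∀ h : V →ₗ[ℂ] V, idealHamiltonian N h ∈ M) (f : Fin N → V →ₗ[ℂ] V) :
    ∑ σ : Equiv.Perm (Fin N), PiTensorProduct.map (fun i => f (σ.symm i)) ∈ M := by
  convert placementSum_mem hM f using 1
  refine Fintype.sum_equiv (Equiv.embeddingEquivOfFinite (Fin N)).symm _ _ fun σ => ?_
  congr 1
  funext i
  obtain ⟨j, rfl⟩ := σ.surjective i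
  rw [Equiv.symm_apply_apply]
  exact (σ.injective.extend_apply f _ j).symm

theorem idealHamiltonian_add (h h' : V →ₗ[ℂ] V) :
    idealHamiltonian N (h + h') = idealHamiltonian N h + idealHamiltonian N h' := by
  simp only [idealHamiltonian, PiTensorProduct.map_update_add, Finset.sum_add_distrib]

theorem idealHamiltonian_smul (c : ℂ) (h : V →ₗ[ℂ] V) :
    idealHamiltonian N (c • h) = c • idealHamiltonian N h := by
  simp only [idealHamiltonian, PiTensorProduct.map_update_smul, Finset.smul_sum]

/-- The operators on `V^{⊗N}` that commute with the exchanges of particles are generated by the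
Hamiltonians of the ideal gas. -/
theorem mem_of_commute_exchange [FiniteDimensional ℂ V]
    {M : Subalgebra ℂ (Module.End ℂ (NParticle V N))}
    (hM : ∀ h : V →ₗ[ℂ] V, h.IsSymmetric → idealHamiltonian N h ∈ M)
    {X : Module.End ℂ (NParticle V N)} (hX : ∀ σ, exchange V N σ * X = X * exchange V N σ) :
    X ∈ M := by
  -- Every operator is a complex combination of two Hermitian ones.
  have hM' : ∀ h : V →ₗ[ℂ] V, idealHamiltonian N h ∈ M := by
    intro h
    have h1 : (h + LinearMap.adjoint h).IsSymmetric := fun x y => by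
      simp [inner_add_left, inner_add_right, LinearMap.adjoint_inner_left,
        LinearMap.adjoint_inner_right, add_comm]
    have h2 : (Complex.I • (h - LinearMap.adjoint h)).IsSymmetric := fun x y => by
      simp [inner_sub_left, inner_sub_right, inner_smul_left, inner_smul_right,
        LinearMap.adjoint_inner_left, LinearMap.adjoint_inner_right]
      ring
    have h3 : h = (2⁻¹ : ℂ) • (h + LinearMap.adjoint h) +
        (-(Complex.I * 2⁻¹)) • (Complex.I • (h - LinearMap.adjoint h)) := by
      rw [smul_smul, show -(Complex.I * 2⁻¹) * Complex.I = (2⁻¹ : ℂ) by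
        linear_combination (-(2⁻¹ : ℂ)) * Complex.I_mul_I, ← smul_add]
      rw [add_add_sub_cancel, ← two_smul ℂ h, smul_smul]
      norm_num
    rw [h3, idealHamiltonian_add, idealHamiltonian_smul, idealHamiltonian_smul]
    exact M.add_mem (M.smul_mem (hM _ h1) _) (M.smul_mem (hM _ h2) _)
  -- `X` is its own average over `S_N`, and averages are sums over all placements of the factors.
  have hav : ∀ Y : Module.End ℂ (NParticle V N),
      ∑ σ, exchange V N σ * Y * exchange V N σ⁻¹ ∈ M := by
    intro Y
    have hY : Y ∈ Submodule.span ℂ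
        (Set.range fun f : Fin N → V →ₗ[ℂ] V => PiTensorProduct.map f) := by
      rw [span_range_map]
      exact Submodule.mem_top
    induction hY using Submodule.span_induction with
    | mem Y hY =>
      obtain ⟨f, rfl⟩ := hY
      convert sum_map_comp_perm_mem hM' f using 2 with σ
      rw [exchange_mul_map, mul_assoc, ← map_mul, mul_inv_cancel, map_one, mul_one]
    | zero => simp [M.zero_mem]
    | add x y _ _ hx hy =>
      simp only [mul_add, add_mul, Finset.sum_add_distrib]
      exact M.add_mem hx hy
    | smul c x _ hx =>
      simp only [mul_smul_comm, smul_mul_assoc, ← Finset.smul_sum]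
      exact M.smul_mem hx c
  have h1 := hav X
  have h2 : ∀ σ, exchange V N σ * X * exchange V N σ⁻¹ = X := by
    intro σ
    rw [hX, mul_assoc, ← map_mul, mul_inv_cancel, map_one, mul_one]
  simp only [h2, Finset.sum_const, Finset.card_univ] at h1
  rw [← Nat.cast_smul_eq_nsmul ℂ] at h1
  have h3 := M.smul_mem h1 ((Fintype.card (Equiv.Perm (Fin N)) : ℂ)⁻¹)
  rwa [smul_smul, inv_mul_cancel₀ (by simp), one_smul] at h3

end TensorPower

/-! ### Traces of permutations on a tensor power -/

section CycleSum

open Equiv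

variable {α : Type*} [Fintype α] [DecidableEq α]

open Classical in
/-- The set of the elements in the same cycle as `a` (just `a`, if it is a fixed point). -/
def cycleClass (σ : Perm α) (a : α) : Finset α := Finset.univ.filter fun b => σ.SameCycle a b

theorem mem_cycleClass {σ : Perm α} {a b : α} : b ∈ cycleClass σ a ↔ σ.SameCycle a b := by
  simp [cycleClass]

theorem cycleClass_eq_iff {σ : Perm α} {a b : α} :
    cycleClass σ a = cycleClass σ b ↔ σ.SameCycle a b := by
  constructor
  · intro h
    rw [← mem_cycleClass, h, mem_cycleClass]
  · intro h
    ext c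
    rw [mem_cycleClass, mem_cycleClass]
    exact ⟨fun h' => h.symm.trans h', fun h' => h.trans h'⟩

theorem cycleClass_of_fixed {σ : Perm α} {a : α} (ha : σ a = a) : cycleClass σ a = {a} := by
  ext b
  rw [mem_cycleClass, Finset.mem_singleton]
  constructor
  · rintro ⟨n, hn⟩
    rw [← hn, Perm.zpow_apply_eq_self_of_apply_eq_self ha]
  · rintro rfl
    exact Perm.SameCycle.rfl

theorem cycleClass_of_not_fixed {σ : Perm α} {a : α} (ha : σ a ≠ a) :
    cycleClass σ a = (σ.cycleOf a).support := by
  ext b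
  rw [mem_cycleClass, Perm.mem_support_cycleOf_iff' ha]

theorem image_cycleClass (σ : Perm α) :
    Finset.univ.image (cycleClass σ) =
      σ.cycleFactorsFinset.image Perm.support ∪ (σ.supportᶜ).image fun a => {a} := by
  ext s
  simp only [Finset.mem_image, Finset.mem_univ, true_and, Finset.mem_union, Finset.mem_compl,
    Perm.mem_support, not_not]
  constructor
  · rintro ⟨a, rfl⟩
    by_cases ha : σ a = a
    · exact Or.inr ⟨a, ha, (cycleClass_of_fixed ha).symm⟩
    · exact Or.inl ⟨σ.cycleOf a, Perm.cycleOf_mem_cycleFactorsFinset_iff.2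
        (Perm.mem_support.2 ha), (cycleClass_of_not_fixed ha).symm⟩
  · rintro (⟨c, hc, rfl⟩ | ⟨a, ha, rfl⟩)
    · obtain ⟨a, ha⟩ := (Perm.mem_cycleFactorsFinset_iff.1 hc).1.nonempty_support
      have hca := Perm.cycle_is_cycleOf ha hc
      refine ⟨a, ?_⟩
      rw [hca, cycleClass_of_not_fixed]
      exact Perm.mem_support.1 (Perm.mem_cycleFactorsFinset_support_le hc ha)
    · exact ⟨a, cycleClass_of_fixed ha⟩

/-- The sizes of the cycle classes are the parts of the cycle type. -/
theorem prod_cycleClass {R : Type*} [CommRing R] (σ : Perm α) (φ : ℕ → R) :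
    ∏ s ∈ Finset.univ.image (cycleClass σ), φ s.card = (σ.partition.parts.map φ).prod := by
  rw [image_cycleClass, Finset.prod_union, Finset.prod_image, Finset.prod_image,
    Perm.parts_partition, Multiset.map_add, Multiset.prod_add, Perm.cycleType_def]
  · rw [Multiset.map_map, Multiset.map_replicate, Multiset.prod_replicate]
    congr 1
    simp [Finset.card_compl]
  · exact fun a _ b _ h => Finset.singleton_injective h
  · intro c hc d hd h
    obtain ⟨a, ha⟩ := (Perm.mem_cycleFactorsFinset_iff.1 hc).1.nonempty_support
    have hd' : a ∈ d.support := by rwa [← show c.support = d.support from h]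
    rw [Perm.cycle_is_cycleOf ha hc, Perm.cycle_is_cycleOf hd' hd]
  · rw [Finset.disjoint_left]
    rintro s hs hs'
    obtain ⟨c, hc, rfl⟩ := Finset.mem_image.1 hs
    obtain ⟨a, -, ha⟩ := Finset.mem_image.1 hs'
    have h2 := (Perm.mem_cycleFactorsFinset_iff.1 hc).1.two_le_card_support
    rw [← ha, Finset.card_singleton] at h2
    omega

/-- The functions that are constant on the cycles of `σ`, summed up: every cycle of length `r`
contributes a factor `∑ x_i ^ r`. -/
theorem sum_invariant_prod {ι R : Type*} [Fintype ι] [DecidableEq ι] [CommRing R] (σ : Perm α)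
    (x : ι → R) :
    ∑ f : α → ι, (if (fun a => f (σ.symm a)) = f then ∏ a, x (f a) else 0) =
      (σ.partition.parts.map fun r => ∑ i, x i ^ r).prod := by
  classical
  let Q := Quotient (Perm.SameCycle.setoid σ)
  let π : α → Q := Quotient.mk _
  have hπ : ∀ a b, π a = π b ↔ σ.SameCycle a b := fun a b => Quotient.eq
  have hinv : ∀ f : α → ι, (fun a => f (σ.symm a)) = f ↔ ∃ F : Q → ι, F ∘ π = f := by
    intro f
    constructor
    · intro h
      have hσ : ∀ (n : ℤ) a, f ((σ ^ n) a) = f a := by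
        have h1 : ∀ a, f (σ a) = f a := fun a => by
          rw [← congrFun h (σ a), Equiv.symm_apply_apply]
        intro n a
        induction n using Int.induction_on with
        | zero => simp
        | succ n ih => rw [add_comm, zpow_add, zpow_one, Perm.mul_apply, h1, ih]
        | pred n ih => rw [← h1, ← Perm.mul_apply, ← zpow_one_add]; simpa using ih
      exact ⟨Quotient.lift f fun a b ⟨n, hn⟩ => by rw [← hn, hσ], rfl⟩
    · rintro ⟨F, rfl⟩
      funext a
      refine congrArg F ((hπ _ _).2 ?_)
      exact ⟨1, by simp⟩
  have hsurj : Function.Surjective π := Quotient.mk_surjective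
  rw [← Finset.sum_filter]
  have h1 : ∑ f : α → ι with (fun a => f (σ.symm a)) = f, ∏ a, x (f a) =
      ∑ F : Q → ι, ∏ a, x (F (π a)) := by
    symm
    refine Finset.sum_bij (fun F _ => F ∘ π) ?_ ?_ ?_ ?_
    · intro F _
      simp only [Finset.mem_filter, Finset.mem_univ, true_and]
      exact (hinv _).2 ⟨F, rfl⟩
    · intro F _ F' _ h
      exact hsurj.injective_comp_right h
    · intro f hf
      obtain ⟨F, hF⟩ := (hinv f).1 (Finset.mem_filter.1 hf).2
      exact ⟨F, Finset.mem_univ _, hF⟩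
    · intro F _
      rfl
  have h2 : ∀ F : Q → ι, ∏ a, x (F (π a)) =
      ∏ q, x (F q) ^ (Finset.univ.filter fun a => π a = q).card := by
    intro F
    rw [← Finset.prod_fiberwise Finset.univ π]
    refine Finset.prod_congr rfl fun q _ => ?_
    rw [← Finset.prod_const]
    refine Finset.prod_congr rfl fun a ha => ?_
    rw [(Finset.mem_filter.1 ha).2]
  have h3 : ∑ F : Q → ι, ∏ q, x (F q) ^ (Finset.univ.filter fun a => π a = q).card =
      ∏ q : Q, ∑ i, x i ^ (Finset.univ.filter fun a => π a = q).card := by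
    rw [Finset.prod_univ_sum, Fintype.piFinset_univ]
  rw [h1, Finset.sum_congr rfl fun F _ => h2 F, h3, ← prod_cycleClass σ fun r => ∑ i, x i ^ r]
  have hfib : ∀ a, (Finset.univ.filter fun b => π b = π a) = cycleClass σ a := by
    intro a
    ext b
    simp only [Finset.mem_filter, Finset.mem_univ, true_and, mem_cycleClass, hπ]
    exact ⟨fun h => h.symm, fun h => h.symm⟩
  refine Finset.prod_bij (fun q _ => Finset.univ.filter fun b => π b = q) ?_ ?_ ?_ ?_
  · intro q _
    obtain ⟨a, rfl⟩ := hsurj q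
    rw [hfib]
    exact Finset.mem_image_of_mem _ (Finset.mem_univ a)
  · intro q _ q' _ h
    obtain ⟨a, rfl⟩ := hsurj q
    obtain ⟨b, rfl⟩ := hsurj q'
    rw [hfib, hfib, cycleClass_eq_iff] at h
    exact (hπ a b).2 h
  · intro s hs
    obtain ⟨a, -, rfl⟩ := Finset.mem_image.1 hs
    exact ⟨π a, Finset.mem_univ _, hfib a⟩
  · intro q _
    rfl

end CycleSum

section TensorTrace

variable {V : Type*} [NormedAddCommGroup V] [InnerProductSpace ℂ V] {N : ℕ}
  {ι : Type*}

theorem exchange_basis (b : Module.Basis ι ℂ V) (σ : Equiv.Perm (Fin N)) (f : Fin N → ι) :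
    exchange V N σ (Basis.piTensorProduct (fun _ => b) f) =
      Basis.piTensorProduct (fun _ => b) fun i => f (σ.symm i) := by
  rw [Basis.piTensorProduct_apply, exchange_tprod, Basis.piTensorProduct_apply]

theorem map_basis {b : Module.Basis ι ℂ V} {x : ι → ℂ} {g : V →ₗ[ℂ] V}
    (hg : ∀ i, g (b i) = x i • b i) (f : Fin N → ι) :
    PiTensorProduct.map (fun _ : Fin N => g) (Basis.piTensorProduct (fun _ => b) f) =
      (∏ i, x (f i)) • Basis.piTensorProduct (fun _ => b) f := by
  rw [Basis.piTensorProduct_apply, PiTensorProduct.map_tprod]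
  simp only [hg]
  exact MultilinearMap.map_smul_univ _ _ _

/-- The trace of `g ⊗ … ⊗ g` followed by a permutation is the product of the power sums of the
eigenvalues of `g` over the cycles of the permutation. -/
theorem trace_map_mul_exchange [Fintype ι] {b : Module.Basis ι ℂ V} {x : ι → ℂ} {g : V →ₗ[ℂ] V}
    (hg : ∀ i, g (b i) = x i • b i) (σ : Equiv.Perm (Fin N)) :
    LinearMap.trace ℂ _ ((PiTensorProduct.map fun _ : Fin N => g) * exchange V N σ) =
      (σ.partition.parts.map fun r => ∑ i, x i ^ r).prod := by
  classical
  rw [LinearMap.trace_eq_matrix_trace ℂ (Basis.piTensorProduct fun _ : Fin N => b),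
    Matrix.trace, ← sum_invariant_prod σ x]
  refine Finset.sum_congr rfl fun f _ => ?_
  rw [Matrix.diag_apply, LinearMap.toMatrix_apply, Module.End.mul_apply, exchange_basis,
    map_basis hg, map_smul, Module.Basis.repr_self, Finsupp.smul_apply, Finsupp.single_apply,
    smul_eq_mul]
  split_ifs with h
  · have h' : ∀ i, f (σ.symm i) = f i := congrFun h
    simp only [h', mul_one]
  · rw [mul_zero]

end TensorTrace

/-! ### Equivariant maps: Maschke's theorem and traces -/

section Equivariant

variable {G W T : Type*} [Group G] [Fintype G] [AddCommGroup W] [Module ℂ W] [AddCommGroup T]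
  [Module ℂ T]

/-- **Maschke's theorem**: an injective equivariant map has an equivariant left inverse. -/
theorem exists_equivariant_leftInverse (ρ : Representation ℂ G W) (τ : Representation ℂ G T)
    (f : W →ₗ[ℂ] T) (hf : Function.Injective f) (hρτ : ∀ g w, f (ρ g w) = τ g (f w)) :
    ∃ r : T →ₗ[ℂ] W, (∀ g t, r (τ g t) = ρ g (r t)) ∧ ∀ w, r (f w) = w := by
  obtain ⟨r₀, hr₀⟩ := f.exists_leftInverse_of_injective (LinearMap.ker_eq_bot.2 hf)
  have hr₀' : ∀ w, r₀ (f w) = w := fun w => LinearMap.congr_fun hr₀ w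
  refine ⟨(Fintype.card G : ℂ)⁻¹ • ∑ g, ρ g ∘ₗ r₀ ∘ₗ τ g⁻¹, fun h t => ?_, fun w => ?_⟩
  · simp only [LinearMap.smul_apply, LinearMap.sum_apply, LinearMap.comp_apply, map_smul, map_sum]
    congr 1
    refine Fintype.sum_equiv (Equiv.mulLeft h⁻¹) _ _ fun g => ?_
    have h1 : τ g⁻¹ (τ h t) = τ (h⁻¹ * g)⁻¹ t := by
      rw [mul_inv_rev, inv_inv, map_mul, Module.End.mul_apply]
    have h2 : ∀ w, ρ h (ρ (h⁻¹ * g) w) = ρ g w := fun w => by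
      rw [← Module.End.mul_apply, ← map_mul, mul_inv_cancel_left]
    rw [Equiv.coe_mulLeft, h1, h2]
  · simp only [LinearMap.smul_apply, LinearMap.sum_apply, LinearMap.comp_apply, ← hρτ, hr₀',
      ← Module.End.mul_apply, ← map_mul]
    simp [← Nat.cast_smul_eq_nsmul ℂ, smul_smul]

/-- The trace of `f ↦ A f B` on linear maps, identified with the tensor product of the dual of `W`
and `T`. -/
theorem trace_sandwich [FiniteDimensional ℂ W] [FiniteDimensional ℂ T] (A : Module.End ℂ T)
    (B : Module.End ℂ W) :
    LinearMap.trace ℂ (W →ₗ[ℂ] T) (LinearMap.compRight ℂ A ∘ₗ LinearMap.lcomp ℂ T B) =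
      LinearMap.trace ℂ T A * LinearMap.trace ℂ W B := by
  let e := dualTensorHomEquiv ℂ W T
  have h : LinearMap.compRight ℂ A ∘ₗ LinearMap.lcomp ℂ T B =
      e.conj (TensorProduct.map (Module.Dual.transpose B) A) := by
    rw [LinearEquiv.conj_apply, LinearEquiv.eq_comp_toLinearMap_symm]
    refine TensorProduct.ext' fun φ t => LinearMap.ext fun w => ?_
    simp [e, Module.Dual.transpose]
  rw [h, LinearMap.trace_conj', LinearMap.trace_tensorProduct', LinearMap.trace_transpose',
    mul_comm]

/-- An operator `D` that commutes with the group acts on the equivariant maps into `T`. -/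
def invariantsPostcomp (ρ : Representation ℂ G W) (τ : Representation ℂ G T) (D : Module.End ℂ T)
    (hD : ∀ g, τ g * D = D * τ g) :
    Module.End ℂ (Representation.linHom ρ τ).invariants :=
  (LinearMap.compRight ℂ D).restrict fun f hf g => by
    refine LinearMap.ext fun w => ?_
    have h1 := LinearMap.congr_fun (hD g) (f (ρ g⁻¹ w))
    have h2 := LinearMap.congr_fun (hf g) w
    exact h1.trans (congrArg D h2)

/-- The trace of `D` on the equivariant maps, as an average over the group. -/
theorem trace_invariantsPostcomp [FiniteDimensional ℂ W] [FiniteDimensional ℂ T]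
    (ρ : Representation ℂ G W) (τ : Representation ℂ G T) (D : Module.End ℂ T)
    (hD : ∀ g, τ g * D = D * τ g) :
    LinearMap.trace ℂ _ (invariantsPostcomp ρ τ D hD) =
      (Fintype.card G : ℂ)⁻¹ * ∑ g, ρ.character g⁻¹ * LinearMap.trace ℂ T (D * τ g) := by
  have : Invertible (Fintype.card G : ℂ) := invertibleOfNonzero (by simp)
  let F : Module.End ℂ (W →ₗ[ℂ] T) :=
    LinearMap.compRight ℂ D ∘ₗ (Representation.linHom ρ τ).averageMap
  have hF : F = (Fintype.card G : ℂ)⁻¹ • ∑ g,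
      LinearMap.compRight ℂ (D * τ g) ∘ₗ LinearMap.lcomp ℂ T (ρ g⁻¹) := by
    refine LinearMap.ext fun f => LinearMap.ext fun w => ?_
    simp [F, Representation.averageMap, GroupAlgebra.average]
  have hmem : ∀ f, F f ∈ (Representation.linHom ρ τ).invariants := fun f =>
    (invariantsPostcomp ρ τ D hD
      ⟨_, Representation.averageMap_invariant (Representation.linHom ρ τ) f⟩).2
  have hres : invariantsPostcomp ρ τ D hD = F.restrict fun f _ => hmem f := by
    refine LinearMap.ext fun f => Subtype.ext ?_
    simp only [invariantsPostcomp, LinearMap.restrict_apply, F, LinearMap.comp_apply]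
    rw [Representation.averageMap_id _ _ f.2]
    rfl
  rw [hres, LinearMap.trace_restrict_eq_of_forall_mem _ _ hmem, hF, map_smul, map_sum]
  simp only [trace_sandwich, smul_eq_mul, Representation.character]
  congr 1
  exact Finset.sum_congr rfl fun g _ => mul_comm _ _

end Equivariant

/-! ### The states and the scalar wave functions determine each other -/

namespace ParticleSystem

variable {V : Type*} [NormedAddCommGroup V] [InnerProductSpace ℂ V] {N : ℕ}
  (S : ParticleSystem V N)

/-- The operators on `V^{⊗N}` that preserve the states, and commute with the scalar wave functions,
form an algebra. -/
def compatibleOperators : Subalgebra ℂ (Module.End ℂ (NParticle V N)) where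
  carrier := {X | ∀ Ψ : S.states, ∃ Ψ' : S.states,
    (∀ k, (Ψ' : Fin S.components → NParticle V N) k = X ((Ψ : Fin S.components → _) k)) ∧
      ∀ Φ ∈ S.waveFunctions, Φ Ψ' = X (Φ Ψ)}
  mul_mem' := by
    intro X Y hX hY Ψ
    obtain ⟨Ψ₁, h1, h1'⟩ := hY Ψ
    obtain ⟨Ψ₂, h2, h2'⟩ := hX Ψ₁
    exact ⟨Ψ₂, fun k => by rw [h2, h1]; rfl, fun Φ hΦ => by rw [h2' Φ hΦ, h1' Φ hΦ]; rfl⟩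
  add_mem' := by
    intro X Y hX hY Ψ
    obtain ⟨Ψ₁, h1, h1'⟩ := hX Ψ
    obtain ⟨Ψ₂, h2, h2'⟩ := hY Ψ
    refine ⟨Ψ₁ + Ψ₂, fun k => ?_, fun Φ hΦ => ?_⟩
    · rw [Submodule.coe_add, Pi.add_apply, h1, h2]; rfl
    · rw [map_add, h1' Φ hΦ, h2' Φ hΦ]; rfl
  algebraMap_mem' := by
    intro c Ψ
    refine ⟨c • Ψ, fun k => ?_, fun Φ _ => ?_⟩
    · rfl
    · rw [map_smul]; rfl

variable {S} in
theorem mem_compatibleOperators {X : Module.End ℂ (NParticle V N)} (hX : X ∈ S.compatibleOperators)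
    (Ψ : S.states) : ∃ Ψ' : S.states,
    (∀ k, (Ψ' : Fin S.components → NParticle V N) k = X ((Ψ : Fin S.components → _) k)) ∧
      ∀ Φ ∈ S.waveFunctions, Φ Ψ' = X (Φ Ψ) := hX Ψ

variable {S} in
/-- The Hamiltonians of the ideal gas preserve the states and commute with the scalar wave functions,
and they generate the operators that commute with permutations. -/
theorem compatible_of_commute [FiniteDimensional ℂ V] {X : Module.End ℂ (NParticle V N)}
    (hX : ∀ σ, exchange V N σ * X = X * exchange V N σ) : X ∈ S.compatibleOperators := by
  refine mem_of_commute_exchange (fun h hh Ψ => ?_) hX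
  refine ⟨S.onStates _ (S.ideal_mem h hh) Ψ, fun k => rfl, fun Φ hΦ => hΦ _ (S.ideal_mem h hh) Ψ⟩

/-- A state is determined by its components. -/
theorem ext_component {Ψ Ψ' : S.states} (h : ∀ k, S.component k Ψ = S.component k Ψ') : Ψ = Ψ' :=
  Subtype.ext (funext h)

/-- `S_N` acts on the linear maps into `V^{⊗N}` by exchanging the particles. -/
def exchangeMaps : Representation ℂ (Equiv.Perm (Fin N)) (S.states →ₗ[ℂ] NParticle V N) where
  toFun σ := LinearMap.compRight ℂ (exchange V N σ)
  map_one' := by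
    refine LinearMap.ext fun Φ => LinearMap.ext fun Ψ => ?_
    simp
  map_mul' σ τ := by
    refine LinearMap.ext fun Φ => LinearMap.ext fun Ψ => ?_
    simp

theorem exchangeMaps_apply (σ : Equiv.Perm (Fin N)) (Φ : S.states →ₗ[ℂ] NParticle V N)
    (Ψ : S.states) : S.exchangeMaps σ Φ Ψ = exchange V N σ (Φ Ψ) := rfl

theorem component_mem_waveFunctions (k : Fin S.components) :
    S.component k ∈ S.waveFunctions := fun _ _ _ => rfl

variable {S} in
theorem exchangeMaps_mem_waveFunctions (hS : S.PermutationInvariant) (σ : Equiv.Perm (Fin N))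
    {Φ : S.states →ₗ[ℂ] NParticle V N} (hΦ : Φ ∈ S.waveFunctions) :
    S.exchangeMaps σ Φ ∈ S.waveFunctions := by
  intro H hH Ψ
  rw [exchangeMaps_apply, exchangeMaps_apply, hΦ H hH Ψ, ← Module.End.mul_apply, hS H hH σ]
  rfl

/-- The scalar wave functions as a representation of `S_N`. -/
def waveRep (hS : S.PermutationInvariant) :
    Representation ℂ (Equiv.Perm (Fin N)) S.waveFunctions :=
  Subrepresentation.toRepresentation
    ⟨S.waveFunctions, fun σ _ hΦ => exchangeMaps_mem_waveFunctions hS σ hΦ⟩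

theorem coe_waveRep_apply (hS : S.PermutationInvariant) (σ : Equiv.Perm (Fin N))
    (Φ : S.waveFunctions) :
    (S.waveRep hS σ Φ : S.states →ₗ[ℂ] NParticle V N) = S.exchangeMaps σ Φ := rfl

/-- An equivariant map `F` from `Hom(ℋ, V^{⊗N})` to `V^{⊗N}` is of the form `Φ ↦ ∑_j X_j Φ(Ψ_j)` for
a basis `(Ψ_j)_j` of the states, where the operators `X_j` commute with permutations. On the scalar
wave functions it is therefore the evaluation at the state `∑_j X_j Ψ_j`. -/
theorem exists_state_of_equivariant [FiniteDimensional ℂ V]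
    (F : (S.states →ₗ[ℂ] NParticle V N) →ₗ[ℂ] NParticle V N)
    (hF : ∀ σ Φ, F (S.exchangeMaps σ Φ) = exchange V N σ (F Φ)) :
    ∃ Ψ : S.states, ∀ Φ ∈ S.waveFunctions, Φ Ψ = F Φ := by
  let b := Module.finBasis ℂ S.states
  let X : Fin (Module.finrank ℂ S.states) → Module.End ℂ (NParticle V N) := fun j =>
    F ∘ₗ LinearMap.smulRightₗ (b.coord j)
  have hXapply : ∀ j t, X j t = F ((b.coord j).smulRight t) := fun j t => rfl
  have hX : ∀ j, X j ∈ S.compatibleOperators := by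
    intro j
    refine compatible_of_commute fun σ => LinearMap.ext fun t => ?_
    rw [Module.End.mul_apply, Module.End.mul_apply, hXapply, hXapply, ← hF]
    congr 1
    refine LinearMap.ext fun Ψ => ?_
    simp [exchangeMaps_apply]
  choose Ψ' _ h' using fun j => mem_compatibleOperators (hX j) (b j)
  refine ⟨∑ j, Ψ' j, fun Φ hΦ => ?_⟩
  have hΦ' : Φ = ∑ j, (b.coord j).smulRight (Φ (b j)) := by
    refine b.ext fun i => ?_
    simp [Finsupp.single_apply, LinearMap.sum_apply]
  conv_rhs => rw [hΦ']
  rw [map_sum, map_sum]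
  exact Finset.sum_congr rfl fun j _ => h' j Φ hΦ

/-- The scalar wave functions are the combinations of the components with permuted particles. -/
theorem waveFunctions_eq_span [FiniteDimensional ℂ V] (hS : S.PermutationInvariant) :
    S.waveFunctions = Submodule.span ℂ
      (Set.range fun p : Equiv.Perm (Fin N) × Fin S.components =>
        exchange V N p.1 ∘ₗ S.component p.2) := by
  set U := Submodule.span ℂ (Set.range fun p : Equiv.Perm (Fin N) × Fin S.components =>
        exchange V N p.1 ∘ₗ S.component p.2) with hU
  have hinv : ∀ (σ : Equiv.Perm (Fin N)), ∀ Φ ∈ U, S.exchangeMaps σ Φ ∈ U := by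
    intro σ
    change U ≤ U.comap (S.exchangeMaps σ)
    rw [hU, Submodule.span_le]
    rintro _ ⟨p, rfl⟩
    refine Submodule.subset_span ⟨(σ * p.1, p.2), ?_⟩
    simp only [map_mul]
    rfl
  have hcomp : ∀ k, S.component k ∈ U := fun k =>
    Submodule.subset_span ⟨(1, k), by simp [Module.End.one_eq_id]⟩
  apply le_antisymm
  · intro Φ hΦ
    let ρU : Representation ℂ (Equiv.Perm (Fin N)) U :=
      Subrepresentation.toRepresentation (ρ := S.exchangeMaps) ⟨U, fun σ Φ => hinv σ Φ⟩
    obtain ⟨r, hr, hr'⟩ := exists_equivariant_leftInverse (W := U)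
      (T := S.states →ₗ[ℂ] NParticle V N) ρU S.exchangeMaps U.subtype U.injective_subtype
      fun _ _ => rfl
    suffices h : (r Φ : S.states →ₗ[ℂ] NParticle V N) = Φ by
      rw [← h]
      exact (r Φ).2
    refine LinearMap.ext fun Ψ => ?_
    -- Evaluation at `Ψ` after the projection to `U` is evaluation at some state `Ψ'`, which has
    -- the same components as `Ψ`, since the components lie in `U`.
    obtain ⟨Ψ', hΨ'⟩ := S.exists_state_of_equivariant
      (LinearMap.applyₗ Ψ ∘ₗ U.subtype ∘ₗ r) (by
        intro σ Φ
        simp only [LinearMap.comp_apply, hr]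
        rfl)
    have h1 : ∀ Φ ∈ S.waveFunctions, Φ Ψ' = (r Φ : S.states →ₗ[ℂ] NParticle V N) Ψ := hΨ'
    have h2 : Ψ' = Ψ := S.ext_component fun k => by
      rw [h1 _ (S.component_mem_waveFunctions k)]
      exact congrArg (fun u : U => (u : S.states →ₗ[ℂ] NParticle V N) Ψ) (hr' ⟨_, hcomp k⟩)
    rw [← h1 Φ hΦ, h2]
  · rw [hU, Submodule.span_le]
    rintro _ ⟨p, rfl⟩
    exact exchangeMaps_mem_waveFunctions hS p.1 (S.component_mem_waveFunctions p.2)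

/-- Evaluation identifies the states with the equivariant maps from the scalar wave functions to
`V^{⊗N}`. -/
def evalMap (hS : S.PermutationInvariant) :
    S.states →ₗ[ℂ] (Representation.linHom (S.waveRep hS) (exchange V N)).invariants :=
  LinearMap.codRestrict _ (S.waveFunctions.subtype.flip) fun Ψ σ => by
    refine LinearMap.ext fun Φ => ?_
    change exchange V N σ (exchange V N σ⁻¹ _) = _
    rw [← Module.End.mul_apply, ← map_mul, mul_inv_cancel, map_one]
    rfl

theorem evalMap_apply (hS : S.PermutationInvariant) (Ψ : S.states) (Φ : S.waveFunctions) :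
    (S.evalMap hS Ψ : S.waveFunctions →ₗ[ℂ] NParticle V N) Φ =
      (Φ : S.states →ₗ[ℂ] NParticle V N) Ψ := rfl

theorem evalMap_bijective [FiniteDimensional ℂ V] (hS : S.PermutationInvariant) :
    Function.Bijective (S.evalMap hS) := by
  constructor
  · intro Ψ Ψ' h
    refine S.ext_component fun k => ?_
    exact congrArg (fun f => f.1 ⟨_, S.component_mem_waveFunctions k⟩) h
  · rintro ⟨F, hF⟩
    have hF' : ∀ σ Φ, F (S.waveRep hS σ Φ) = exchange V N σ (F Φ) := by
      intro σ Φ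
      have h := LinearMap.congr_fun (hF σ) (S.waveRep hS σ Φ)
      rw [← h]
      change exchange V N σ (F ((S.waveRep hS σ⁻¹ * S.waveRep hS σ) Φ)) = _
      rw [← map_mul, inv_mul_cancel, map_one]
      rfl
    obtain ⟨r, hr, hr'⟩ := exists_equivariant_leftInverse (W := S.waveFunctions)
      (T := S.states →ₗ[ℂ] NParticle V N) (S.waveRep hS) S.exchangeMaps
      S.waveFunctions.subtype S.waveFunctions.injective_subtype fun _ _ => rfl
    obtain ⟨Ψ, hΨ⟩ := S.exists_state_of_equivariant (F ∘ₗ r) (by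
      intro σ Φ
      rw [LinearMap.comp_apply, hr, hF']
      rfl)
    refine ⟨Ψ, Subtype.ext (LinearMap.ext fun Φ => ?_)⟩
    rw [evalMap_apply, hΨ Φ Φ.2]
    exact congrArg F (hr' Φ)

/-- An operator that commutes with permutations has, on the states, a trace that is determined by
the character of the representation of `S_N` on the scalar wave functions. -/
theorem trace_states [FiniteDimensional ℂ V] (hS : S.PermutationInvariant)
    {D : Module.End ℂ (NParticle V N)}
    (hD : ∀ σ, exchange V N σ * D = D * exchange V N σ) (D' : Module.End ℂ S.states)
    (hD' : ∀ Ψ k, S.component k (D' Ψ) = D (S.component k Ψ)) :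
    LinearMap.trace ℂ _ D' = (Fintype.card (Equiv.Perm (Fin N)) : ℂ)⁻¹ *
      ∑ σ, Representation.character (V := S.waveFunctions) (S.waveRep hS) σ⁻¹ *
        LinearMap.trace ℂ _ (D * exchange V N σ) := by
  have hwave : ∀ Φ ∈ S.waveFunctions, ∀ Ψ, Φ (D' Ψ) = D (Φ Ψ) := by
    intro Φ hΦ Ψ
    obtain ⟨Ψ', h1, h2⟩ := mem_compatibleOperators (compatible_of_commute (S := S) hD) Ψ
    have h3 : D' Ψ = Ψ' := S.ext_component fun k => (hD' Ψ k).trans (h1 k).symm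
    rw [h3, h2 Φ hΦ]
  rw [← trace_invariantsPostcomp (W := S.waveFunctions) (T := NParticle V N) (S.waveRep hS)
    (exchange V N) D hD]
  let e := LinearEquiv.ofBijective (S.evalMap hS) (S.evalMap_bijective hS)
  rw [← LinearMap.trace_conj'
    (N := (Representation.linHom (S.waveRep hS) (exchange V N)).invariants) D' e]
  congr 1
  rw [LinearEquiv.conj_apply, LinearEquiv.comp_toLinearMap_symm_eq]
  refine LinearMap.ext fun Ψ => Subtype.ext (LinearMap.ext fun Φ => ?_)
  exact hwave Φ Φ.2 Ψ

end ParticleSystem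

/-! ### The partition function -/

section Gibbs

variable {M : Type*} [AddCommGroup M] [Module ℂ M]

/-- For a diagonalizable `T`, the operator which is `exp (-β μ)` on the eigenspace of `T` for `μ`
has the trace `tr exp (-β T)`. -/
theorem gibbsTrace_eq_trace [FiniteDimensional ℂ M] {β : ℝ} {T D : Module.End ℂ M}
    (hT : ⨆ μ, T.eigenspace μ = ⊤)
    (hD : ∀ μ v, T v = μ • v → D v = Complex.exp (-β * μ) • v) :
    gibbsTrace β T = LinearMap.trace ℂ M D := by
  classical
  -- The eigenvectors span the space, so there is a basis `b` of eigenvectors.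
  set s : Set M := {v | ∃ μ : ℂ, T v = μ • v} with hs
  have hspan : ⊤ ≤ Submodule.span ℂ s := by
    rw [← hT]
    exact iSup_le fun μ v hv =>
      Submodule.subset_span ⟨μ, Module.End.mem_eigenspace_iff.1 hv⟩
  set b₀ := Module.Basis.ofSpan hspan with hb₀
  have hfin := FiniteDimensional.fintypeBasisIndex b₀
  set b := b₀.reindex (Fintype.equivFinOfCardEq (Module.finrank_eq_card_basis b₀).symm) with hb
  have hbs : ∀ i, ∃ μ : ℂ, T (b i) = μ • b i := by
    intro i
    rw [hb, Module.Basis.reindex_apply]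
    exact Module.Basis.ofSpan_subset hspan ⟨_, rfl⟩
  choose μ hμ using hbs
  set c := Module.finBasis ℂ M
  have hTb : LinearMap.toMatrix b b T = Matrix.diagonal μ := by
    ext i j
    rw [LinearMap.toMatrix_apply, hμ, map_smul, Module.Basis.repr_self, Finsupp.smul_apply,
      Finsupp.single_apply, Matrix.diagonal_apply]
    by_cases h : i = j
    · subst h; simp
    · simp [h, Ne.symm h]
  have hDb : LinearMap.toMatrix b b D =
      Matrix.diagonal fun i => Complex.exp (-β * μ i) := by
    ext i j
    rw [LinearMap.toMatrix_apply, hD _ _ (hμ j), map_smul, Module.Basis.repr_self,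
      Finsupp.smul_apply, Finsupp.single_apply, Matrix.diagonal_apply]
    by_cases h : i = j
    · subst h; simp
    · simp [h, Ne.symm h]
  set U := c.toMatrix b with hU
  have hUU : U * b.toMatrix c = 1 := Module.Basis.toMatrix_mul_toMatrix_flip c b
  have hUU' : b.toMatrix c * U = 1 := Module.Basis.toMatrix_mul_toMatrix_flip b c
  have hinv : U⁻¹ = b.toMatrix c := Matrix.inv_eq_right_inv hUU
  have hUu : IsUnit U := IsUnit.of_mul_eq_one _ hUU
  have hTc : (-β : ℂ) • LinearMap.toMatrix c c T =
      U * Matrix.diagonal (fun i => (-β : ℂ) * μ i) * U⁻¹ := by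
    rw [← basis_toMatrix_mul_linearMap_toMatrix_mul_basis_toMatrix c b c b T, hTb, hinv,
      show (fun i => (-β : ℂ) * μ i) = (-β : ℂ) • μ from rfl, Matrix.diagonal_smul,
      Matrix.mul_smul, Matrix.smul_mul]
  rw [gibbsTrace, hTc, Matrix.exp_conj U _ hUu, Matrix.exp_diagonal, Matrix.trace_mul_comm,
    ← Matrix.mul_assoc, hinv, hUU', Matrix.one_mul, LinearMap.trace_eq_matrix_trace ℂ b, hDb]
  congr 2
  funext i
  rw [Pi.coe_exp, Complex.exp_eq_exp_ℂ]

theorem iSup_eigenspace_eq_top_of_basis {ι : Type*} (b : Module.Basis ι ℂ M) {T : Module.End ℂ M}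
    {μ : ι → ℂ} (hT : ∀ i, T (b i) = μ i • b i) : ⨆ μ, T.eigenspace μ = ⊤ := by
  rw [eq_top_iff, ← b.span_eq, Submodule.span_le]
  rintro _ ⟨i, rfl⟩
  exact Submodule.mem_iSup_of_mem (μ i) (Module.End.mem_eigenspace_iff.2 (hT i))

/-- Functional calculus for an operator that is diagonal in a basis. -/
theorem eq_smul_of_basis {ι : Type*} (b : Module.Basis ι ℂ M) {T D : Module.End ℂ M}
    {μ : ι → ℂ} {φ : ℂ → ℂ} (hT : ∀ i, T (b i) = μ i • b i) (hD : ∀ i, D (b i) = φ (μ i) • b i)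
    {ν : ℂ} {v : M} (hv : T v = ν • v) : D v = φ ν • v := by
  have key : ∀ (A : Module.End ℂ M) (κ : ι → ℂ), (∀ i, A (b i) = κ i • b i) →
      ∀ w i, b.repr (A w) i = κ i * b.repr w i := by
    classical
    intro A κ hA w i
    have : b.coord i ∘ₗ A = κ i • b.coord i := by
      refine b.ext fun j => ?_
      rw [LinearMap.comp_apply, hA, map_smul, LinearMap.smul_apply, b.coord_apply,
        Module.Basis.repr_self, smul_eq_mul, smul_eq_mul, Finsupp.single_apply]
      split_ifs with h
      · rw [h]
      · simp
    exact LinearMap.congr_fun this w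
  refine b.ext_elem fun i => ?_
  have h1 := key T μ hT v i
  rw [hv] at h1
  rw [key D _ hD]
  simp only [map_smul, Finsupp.smul_apply, smul_eq_mul] at h1 ⊢
  rcases mul_eq_mul_right_iff.1 h1 with h | h
  · rw [h]
  · simp [h]

end Gibbs

section TensorEigen

variable {V : Type*} [NormedAddCommGroup V] [InnerProductSpace ℂ V] {N : ℕ} {ι : Type*}

theorem idealHamiltonian_basis {b : Module.Basis ι ℂ V} {ε : ι → ℂ} {h : V →ₗ[ℂ] V}
    (hh : ∀ i, h (b i) = ε i • b i) (f : Fin N → ι) :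
    idealHamiltonian N h (Basis.piTensorProduct (fun _ => b) f) =
      (∑ i, ε (f i)) • Basis.piTensorProduct (fun _ => b) f := by
  rw [idealHamiltonian, LinearMap.sum_apply, Finset.sum_smul]
  refine Finset.sum_congr rfl fun i _ => ?_
  rw [Basis.piTensorProduct_apply, PiTensorProduct.map_tprod]
  have : (fun j => (Function.update (fun _ : Fin N => (LinearMap.id : V →ₗ[ℂ] V)) i h j)
      (b (f j))) = Function.update (fun j => b (f j)) i (ε (f i) • b (f i)) := by
    funext j
    by_cases hj : j = i
    · subst hj; simp [hh]
    · simp [hj]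
  rw [this, MultilinearMap.map_update_smul, Function.update_eq_self]

end TensorEigen

namespace ParticleSystem

variable {V : Type*} [NormedAddCommGroup V] [InnerProductSpace ℂ V] {N : ℕ}
  (S : ParticleSystem V N)

/-- `exp (-β H_N)` is the `N`-th tensor power of `exp (-β h)`, so its trace over the states is given
by `trace_states` and `trace_map_mul_exchange`. -/
theorem partitionFunction_eq_sum_character [FiniteDimensional ℂ V] (hS : S.PermutationInvariant)
    (h : V →ₗ[ℂ] V) (hh : h.IsSymmetric) (β : ℝ) :
    S.partitionFunction h hh β = (N.factorial : ℂ)⁻¹ *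
      ∑ σ, Representation.character (V := S.waveFunctions) (S.waveRep hS) σ *
        (σ.partition.parts.map fun r => ∑ i : Fin (Module.finrank ℂ V),
          ((Real.exp (-β * hh.eigenvalues rfl i) : ℝ) : ℂ) ^ r).prod := by
  classical
  set b := (hh.eigenvectorBasis rfl).toBasis with hb
  set ε : Fin (Module.finrank ℂ V) → ℂ := fun i => (hh.eigenvalues rfl i : ℂ) with hε
  set x : Fin (Module.finrank ℂ V) → ℂ :=
    fun i => ((Real.exp (-β * hh.eigenvalues rfl i) : ℝ) : ℂ) with hx
  have hxε : ∀ i, x i = Complex.exp (-β * ε i) := by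
    intro i
    simp only [hx, hε]
    push_cast
    rfl
  have hhb : ∀ i, h (b i) = ε i • b i := by
    intro i
    rw [hb, OrthonormalBasis.coe_toBasis]
    exact hh.apply_eigenvectorBasis rfl i
  -- `g` is `exp (-β h)`, and `D` is its `N`-th tensor power `exp (-β H_N)`.
  set g : V →ₗ[ℂ] V := b.constr ℂ fun i => x i • b i with hg'
  have hg : ∀ i, g (b i) = x i • b i := fun i => b.constr_basis ℂ _ i
  set D : Module.End ℂ (NParticle V N) := PiTensorProduct.map fun _ => g with hDdef
  have hDcomm : ∀ σ, exchange V N σ * D = D * exchange V N σ := fun σ => exchange_mul_map σ _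
  have hmem : ∀ Ψ ∈ S.states, D.compLeft (Fin S.components) Ψ ∈ S.states := by
    intro Ψ hΨ
    obtain ⟨Ψ', h1, -⟩ :=
      mem_compatibleOperators (compatible_of_commute (S := S) hDcomm) ⟨Ψ, hΨ⟩
    have : D.compLeft (Fin S.components) Ψ = Ψ' := funext fun k => (h1 k).symm
    rw [this]
    exact Ψ'.2
  set B : Module.Basis ((_ : Fin S.components) × (Fin N → Fin (Module.finrank ℂ V))) ℂ
    (Fin S.components → NParticle V N) :=
      Pi.basis fun _ => Basis.piTensorProduct fun _ => b with hB
  have hBapply : ∀ (A : Module.End ℂ (NParticle V N)) (κ : (Fin N → Fin (Module.finrank ℂ V)) → ℂ),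
      (∀ f, A (Basis.piTensorProduct (fun _ => b) f) =
        κ f • Basis.piTensorProduct (fun _ => b) f) →
      ∀ p, A.compLeft (Fin S.components) (B p) = κ p.2 • B p := by
    intro A κ hA p
    funext k
    rw [hB, Pi.basis_apply]
    by_cases hk : k = p.1
    · subst hk
      simpa using hA p.2
    · simp [hk]
  have hTB := hBapply (idealHamiltonian N h) _ (idealHamiltonian_basis hhb)
  have hDB := hBapply D (fun f => Complex.exp (-β * ∑ i, ε (f i))) (by
    intro f
    rw [hDdef, map_basis hg]
    congr 1
    rw [Finset.mul_sum, Complex.exp_sum]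
    exact Finset.prod_congr rfl fun i _ => hxε _)
  have htop : ⨆ μ, (S.onStates (idealHamiltonian N h) (S.ideal_mem h hh)).eigenspace μ = ⊤ :=
    Module.End.genEigenspace_restrict_eq_top (k := 1) _ (iSup_eigenspace_eq_top_of_basis B hTB)
  rw [partitionFunction, gibbsTrace_eq_trace (D := (D.compLeft (Fin S.components)).restrict hmem)
    htop, S.trace_states hS hDcomm _ fun Ψ k => rfl]
  · have hcard : Fintype.card (Equiv.Perm (Fin N)) = N.factorial := by
      rw [Fintype.card_perm, Fintype.card_fin]
    rw [hcard]
    congr 1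
    -- `σ` and `σ⁻¹` have the same cycle type.
    refine Fintype.sum_equiv (Equiv.inv _) _ _ fun σ => ?_
    have hinv : (σ⁻¹).partition = σ.partition :=
      Equiv.Perm.partition_eq_of_isConj.1
        (Equiv.Perm.isConj_iff_cycleType_eq.2 (Equiv.Perm.cycleType_inv σ))
    rw [trace_map_mul_exchange hg, Equiv.inv_apply, hinv]
  · intro μ v hv
    refine Subtype.ext ?_
    exact eq_smul_of_basis B (φ := fun μ => Complex.exp (-β * μ)) hTB hDB (congrArg Subtype.val hv)

/-- The multiplicities of the Specht modules among the scalar wave functions give the expansion of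
the partition function in Schur functions. -/
theorem partitionFunction_eq_sum_schurFunction [FiniteDimensional ℂ V]
    (hS : S.PermutationInvariant) {C : N.Partition → ℕ}
    (Φ : Module.Basis (PhaseIndex C) ℂ S.waveFunctions)
    (hΦ : ∀ σ j, S.waveRep hS σ (Φ j) = ∑ j', permutationPhase C σ j' j • Φ j')
    (h : V →ₗ[ℂ] V) (hh : h.IsSymmetric) (β : ℝ) :
    S.partitionFunction h hh β = ∑ I : N.Partition, (C I : ℂ) * schurFunction I
      (fun i : Fin (Module.finrank ℂ V) =>
        ((Real.exp (-β * hh.eigenvalues rfl i) : ℝ) : ℂ)) := by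
  classical
  have hχ : ∀ σ, Representation.character (V := S.waveFunctions) (S.waveRep hS) σ =
      ∑ I, (C I : ℂ) * simpleCharacter I σ := by
    intro σ
    have hmat : LinearMap.toMatrix Φ Φ (S.waveRep hS σ) = permutationPhase C σ := by
      ext i j
      rw [LinearMap.toMatrix_apply, hΦ, map_sum, Finsupp.finsetSum_apply]
      simp [Finsupp.single_apply]
    rw [Representation.character, LinearMap.trace_eq_matrix_trace ℂ Φ, hmat, permutationPhase,
      Matrix.trace_blockDiagonal']
    refine Finset.sum_congr rfl fun I _ => ?_
    rw [Matrix.trace_blockDiagonal, Finset.sum_const, Finset.card_univ, Fintype.card_fin,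
      nsmul_eq_mul, simpleCharacter, LinearMap.trace_eq_matrix_trace ℂ
        (Module.finBasis ℂ (spechtModule I)), spechtMatrix]
  rw [S.partitionFunction_eq_sum_character hS]
  simp only [hχ, schurFunction, Finset.sum_mul, Finset.mul_sum]
  rw [Finset.sum_comm]
  refine Finset.sum_congr rfl fun I _ => Finset.sum_congr rfl fun σ _ => ?_
  ring

end ParticleSystem

/-! ### Linear independence of the products of power sums -/

section PowerSums

open MvPolynomial

/-- A surjective endomorphism of a Noetherian ring is injective. -/
theorem injective_of_surjective_ringEnd {A : Type*} [CommRing A] [IsNoetherianRing A] (f : A →+* A)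
    (hf : Function.Surjective f) : Function.Injective f := by
  have hsucc : ∀ (n : ℕ) (x : A), (f ^ (n + 1)) x = (f ^ n) (f x) := fun n x => by rw [pow_succ]; rfl
  have hsucc' : ∀ (n : ℕ) (x : A), (f ^ (n + 1)) x = f ((f ^ n) x) := fun n x => by rw [pow_succ']; rfl
  have hsurj : ∀ n : ℕ, Function.Surjective (f ^ n) := by
    intro n
    induction n with
    | zero => exact Function.surjective_id
    | succ n ih =>
      intro y
      obtain ⟨x, hx⟩ := ih y
      obtain ⟨z, rfl⟩ := hf x
      exact ⟨z, (hsucc n z).trans hx⟩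
  let K : ℕ →o Ideal A := ⟨fun n => RingHom.ker (f ^ n), monotone_nat_of_le_succ fun n x hx => by
    rw [RingHom.mem_ker] at hx ⊢
    rw [hsucc', hx, map_zero]⟩
  -- The kernels of the powers of `f` form an ascending chain of ideals.
  obtain ⟨n, hn⟩ := monotone_stabilizes_iff_noetherian.2 (inferInstance : IsNoetherian A A) K
  rw [injective_iff_map_eq_zero]
  intro x hx
  obtain ⟨y, rfl⟩ := hsurj n x
  have h1 : y ∈ K (n + 1) := by
    change (f ^ (n + 1)) y = 0
    rw [hsucc', hx]
  rw [← hn (n + 1) n.le_succ] at h1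
  exact h1

/-- Newton's identities express the elementary symmetric polynomials by the power sums. -/
theorem esymm_mem_range_aeval_psum (m k : ℕ) (hk : k ≤ m) :
    esymm (Fin m) ℂ k ∈
      (aeval (R := ℂ) fun i : Fin m => psum (Fin m) ℂ (i + 1)).range := by
  induction k using Nat.strong_induction_on with
  | _ k ih =>
    rcases Nat.eq_zero_or_pos k with rfl | hpos
    · rw [esymm_zero]
      exact one_mem _
    · set A := (aeval (R := ℂ) fun i : Fin m => psum (Fin m) ℂ (i + 1)).range with hA
      have hneg : (-1 : MvPolynomial (Fin m) ℂ) ∈ A := neg_mem (one_mem _)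
      have h1 : (k : MvPolynomial (Fin m) ℂ) * esymm (Fin m) ℂ k ∈ A := by
        rw [mul_esymm_eq_sum]
        refine mul_mem (pow_mem hneg _) (sum_mem fun a ha => ?_)
        rw [Finset.mem_filter, Finset.HasAntidiagonal.mem_antidiagonal] at ha
        refine mul_mem (mul_mem (pow_mem hneg _) (ih a.1 ha.2 (by omega))) ?_
        refine ⟨X ⟨a.2 - 1, by omega⟩, ?_⟩
        rw [AlgHom.toRingHom_eq_coe, RingHom.coe_coe, aeval_X]
        congr 1
        simp only
        omega
      have h2 : esymm (Fin m) ℂ k =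
          (k : ℂ)⁻¹ • ((k : MvPolynomial (Fin m) ℂ) * esymm (Fin m) ℂ k) := by
        have hk0 : (k : ℂ) ≠ 0 := Nat.cast_ne_zero.2 hpos.ne'
        rw [← nsmul_eq_mul, ← Nat.cast_smul_eq_nsmul ℂ, smul_smul, inv_mul_cancel₀ hk0, one_smul]
      rw [h2]
      exact A.smul_mem h1 _

/-- The first `m` power sums in `m` variables are algebraically independent: they generate the
symmetric polynomials, which form a polynomial ring in `m` variables. -/
theorem aeval_psum_injective (m : ℕ) :
    Function.Injective (aeval (R := ℂ) fun i : Fin m => psum (Fin m) ℂ (i + 1)) := by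
  set θ : MvPolynomial (Fin m) ℂ →ₐ[ℂ] symmetricSubalgebra (Fin m) ℂ :=
    aeval fun i : Fin m => ⟨psum (Fin m) ℂ (i + 1), psum_isSymmetric _ _ _⟩ with hθ
  have hval : ∀ p, (θ p : MvPolynomial (Fin m) ℂ) =
      aeval (fun i : Fin m => psum (Fin m) ℂ (i + 1)) p := fun p =>
    (Subalgebra.mvPolynomial_aeval_coe _ _ _).symm
  set e := esymmAlgEquiv (Fin m) ℂ (Fintype.card_fin m) with he
  have hsurj : Function.Surjective θ := by
    rw [← AlgHom.range_eq_top, eq_top_iff]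
    intro s _
    obtain ⟨p, rfl⟩ := e.surjective s
    induction p using MvPolynomial.induction_on with
    | C a =>
      rw [← algebraMap_eq, e.commutes]
      exact Subalgebra.algebraMap_mem _ _
    | add p q hp hq => rw [map_add]; exact add_mem (hp trivial) (hq trivial)
    | mul_X p i hp =>
      rw [map_mul]
      refine mul_mem (hp trivial) ?_
      obtain ⟨q, hq⟩ := esymm_mem_range_aeval_psum m (i + 1) i.2
      refine ⟨q, Subtype.ext ?_⟩
      refine (hval q).trans (hq.trans ?_)
      rw [he, esymmAlgEquiv_apply, esymmAlgHom_apply, aeval_X]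
  have hinj : Function.Injective (e.symm ∘ θ) :=
    injective_of_surjective_ringEnd (e.symm.toAlgHom.comp θ).toRingHom
      (e.symm.surjective.comp hsurj)
  intro p q hpq
  refine hinj (congrArg e.symm (Subtype.ext ?_))
  rw [hval, hval]
  exact hpq

/-- The products of power sums of degree `n` are linearly independent if there are at least `n`
variables. -/
theorem linearIndependent_psumPart {m n : ℕ} (hn : n ≤ m) :
    LinearIndependent ℂ fun I : n.Partition => psumPart (Fin m) ℂ I := by
  classical
  -- The exponents of the monomial which becomes `psumPart I` when the variable `X i` is replaced
  -- by the power sum of degree `i + 1`.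
  let d : n.Partition → (Fin m →₀ ℕ) := fun I =>
    Finsupp.equivFunOnFinite.symm fun i => I.parts.count ((i : ℕ) + 1)
  have hrange : ∀ (I : n.Partition) (a : ℕ), a ∈ I.parts → ∃ i : Fin m, (i : ℕ) + 1 = a := by
    intro I a ha
    have h1 := I.parts_pos ha
    have h2 : a ≤ n := I.parts_sum ▸ Multiset.le_sum_of_mem ha
    exact ⟨⟨a - 1, by omega⟩, Nat.sub_add_cancel h1⟩
  have hd : Function.Injective d := by
    intro I J hIJ
    refine Nat.Partition.ext (Multiset.ext.2 fun a => ?_)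
    by_cases ha : ∃ i : Fin m, (i : ℕ) + 1 = a
    · obtain ⟨i, rfl⟩ := ha
      exact DFunLike.congr_fun hIJ i
    · rw [Multiset.count_eq_zero_of_notMem fun h => ha (hrange I a h),
        Multiset.count_eq_zero_of_notMem fun h => ha (hrange J a h)]
  have hp : ∀ I, psumPart (Fin m) ℂ I =
      aeval (fun i : Fin m => psum (Fin m) ℂ (i + 1)) (monomial (d I) (1 : ℂ)) := by
    intro I
    rw [aeval_monomial, map_one, one_mul, Finsupp.prod_fintype _ _ (by simp), psumPart,
      Finset.prod_multiset_map_count]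
    let succEmb : Fin m ↪ ℕ := ⟨fun i => (i : ℕ) + 1, fun i j h => Fin.ext (Nat.succ_injective h)⟩
    have hsub : I.parts.toFinset ⊆ Finset.univ.map succEmb := by
      intro a ha
      obtain ⟨i, hi⟩ := hrange I a (Multiset.mem_toFinset.1 ha)
      exact Finset.mem_map.2 ⟨i, Finset.mem_univ _, hi⟩
    rw [Finset.prod_subset hsub fun a _ ha => by
      rw [Multiset.count_eq_zero_of_notMem fun h => ha (Multiset.mem_toFinset.2 h), pow_zero],
      Finset.prod_map]
    rfl
  have hli := (basisMonomials (Fin m) ℂ).linearIndependent.comp d hd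
  have h2 := hli.map' (aeval (R := ℂ) fun i : Fin m => psum (Fin m) ℂ (i + 1)).toLinearMap
    (LinearMap.ker_eq_bot.2 (aeval_psum_injective m))
  rw [coe_basisMonomials] at h2
  exact (funext hp : (fun I => psumPart (Fin m) ℂ I) = _) ▸ h2

end PowerSums

/-! ### The partition function determines the multiplicities -/

section SchurIndependence

variable {N : ℕ}

/-- A sum of products of power sums over the cycles of the permutations vanishes for positive
arguments only if its coefficients, constant on the permutations of a given cycle type, vanish. -/
theorem eq_zero_of_sum_mul_prod_psum_eq_zero {m : ℕ} (hN : N ≤ m) {a : Equiv.Perm (Fin N) → ℂ}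
    (ha : ∀ σ τ : Equiv.Perm (Fin N), σ.partition = τ.partition → a σ = a τ)
    (h : ∀ y : Fin m → ℝ, (∀ i, 0 < y i) →
      ∑ σ, a σ * (σ.partition.parts.map fun r => ∑ i, (y i : ℂ) ^ r).prod = 0) :
    a = 0 := by
  classical
  have h0 : ∑ σ : Equiv.Perm (Fin N), a σ • MvPolynomial.psumPart (Fin m) ℂ σ.partition = 0 := by
    refine MvPolynomial.funext_set (fun _ => (fun t : ℝ => (t : ℂ)) '' Set.Ioi 0) (fun _ => ?_) ?_
    · exact (Set.Ioi_infinite (0 : ℝ)).image Complex.ofReal_injective.injOn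
    · intro x hx
      choose y hy hyx using fun i => hx i (Set.mem_univ i)
      obtain rfl : (fun i => (y i : ℂ)) = x := funext hyx
      rw [map_zero, ← h y hy, map_sum]
      refine Finset.sum_congr rfl fun σ _ => ?_
      rw [MvPolynomial.smul_eval, MvPolynomial.psumPart, map_multiset_prod, Multiset.map_map]
      congr 3
      funext r
      simp [MvPolynomial.psum]
  have hcard : Fintype.card (Fin N) ≤ m := by rwa [Fintype.card_fin]
  have h1 : ∑ J : (Fintype.card (Fin N)).Partition,
      (∑ σ : Equiv.Perm (Fin N) with σ.partition = J, a σ) •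
        MvPolynomial.psumPart (Fin m) ℂ J = 0 := by
    rw [← h0, ← Finset.sum_fiberwise Finset.univ (fun σ : Equiv.Perm (Fin N) => σ.partition)]
    refine Finset.sum_congr rfl fun J _ => ?_
    rw [Finset.sum_smul]
    refine Finset.sum_congr rfl fun σ hσ => ?_
    rw [(Finset.mem_filter.1 hσ).2]
  funext τ
  have h2 := Fintype.linearIndependent_iff.1 (linearIndependent_psumPart hcard) _ h1 τ.partition
  rw [Finset.sum_congr rfl fun σ hσ => ha σ τ (Finset.mem_filter.1 hσ).2, Finset.sum_const,
    nsmul_eq_mul] at h2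
  refine (mul_eq_zero.1 h2).resolve_left (Nat.cast_ne_zero.2 (Finset.card_pos.2 ⟨τ, ?_⟩).ne')
  exact Finset.mem_filter.2 ⟨Finset.mem_univ _, rfl⟩

/-- The Schur functions of degree `N` in at least `N` positive variables are linearly
independent. -/
theorem eq_zero_of_sum_mul_schurFunction_eq_zero {m : ℕ} (hN : N ≤ m) {c : N.Partition → ℂ}
    (h : ∀ y : Fin m → ℝ, (∀ i, 0 < y i) →
      ∑ I, c I * schurFunction I (fun i => (y i : ℂ)) = 0) : c = 0 := by
  have h1 : (fun σ => ∑ I, c I * simpleCharacter I σ) = 0 := by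
    refine eq_zero_of_sum_mul_prod_psum_eq_zero hN (fun σ τ hστ => ?_) fun y hy => ?_
    · exact Finset.sum_congr rfl fun I _ =>
        congrArg (c I * ·) (character_eq_of_partition_eq (spechtRep I) hστ)
    · have h2 : (N.factorial : ℂ) ≠ 0 := Nat.cast_ne_zero.2 N.factorial_ne_zero
      rw [← mul_right_inj' (inv_ne_zero h2), mul_zero, ← h y hy]
      simp only [schurFunction, Finset.sum_mul, Finset.mul_sum]
      rw [Finset.sum_comm]
      refine Finset.sum_congr rfl fun I _ => Finset.sum_congr rfl fun σ _ => ?_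
      ring
  funext I
  refine Fintype.linearIndependent_iff.1 (linearIndependent_simpleCharacter (N := N)) c ?_ I
  rw [← h1]
  funext σ
  simp

end SchurIndependence

section Spectrum

variable {V : Type*} [AddCommGroup V] [Module ℂ V]

/-- The sum of `φ` over the spectrum does not depend on the eigenbasis. -/
theorem sum_apply_eigenvalues_eq {ι κ : Type*} [Fintype ι] [Fintype κ] (b : Module.Basis ι ℂ V)
    (b' : Module.Basis κ ℂ V) {T : Module.End ℂ V} {μ : ι → ℂ} {μ' : κ → ℂ}
    (hb : ∀ i, T (b i) = μ i • b i) (hb' : ∀ i, T (b' i) = μ' i • b' i) (φ : ℂ → ℂ) :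
    ∑ i, φ (μ i) = ∑ i, φ (μ' i) := by
  classical
  have key : ∀ {ι : Type _} [Fintype ι] (b : Module.Basis ι ℂ V) (D : Module.End ℂ V)
      (x : ι → ℂ), (∀ i, D (b i) = x i • b i) → LinearMap.trace ℂ V D = ∑ i, x i := by
    intro ι _ b D x hD
    classical
    rw [LinearMap.trace_eq_matrix_trace ℂ b, Matrix.trace]
    refine Finset.sum_congr rfl fun i _ => ?_
    simp [LinearMap.toMatrix_apply, hD]
  set D : Module.End ℂ V := b.constr ℂ fun i => φ (μ i) • b i with hD
  have hDb : ∀ i, D (b i) = φ (μ i) • b i := fun i => b.constr_basis ℂ _ i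
  have hDb' : ∀ i, D (b' i) = φ (μ' i) • b' i := fun i => eq_smul_of_basis b hb hDb (hb' i)
  let e := b.indexEquiv b'
  rw [← key b D _ hDb, ← Equiv.sum_comp e, ← key (b'.reindex e.symm) D (fun i => φ (μ' (e i))) ?_]
  intro i
  rw [Module.Basis.reindex_apply]
  exact hDb' _

end Spectrum

namespace ParticleSystem

variable {V : Type*} [NormedAddCommGroup V] [InnerProductSpace ℂ V] [FiniteDimensional ℂ V] {N : ℕ}

/-- Every family of positive numbers consists of the Boltzmann factors of some Hermitian
one-particle Hamiltonian, up to the order. -/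
theorem exists_isSymmetric_power_sums {β : ℝ} (hβ : β ≠ 0)
    {y : Fin (Module.finrank ℂ V) → ℝ} (hy : ∀ i, 0 < y i) :
    ∃ (h : V →ₗ[ℂ] V) (hh : h.IsSymmetric), ∀ r : ℕ,
      ∑ i, ((Real.exp (-β * hh.eigenvalues rfl i) : ℝ) : ℂ) ^ r = ∑ i, (y i : ℂ) ^ r := by
  set b := stdOrthonormalBasis ℂ V with hb
  set ε : Fin (Module.finrank ℂ V) → ℝ := fun i => -Real.log (y i) / β with hε
  set h : V →ₗ[ℂ] V := b.toBasis.constr ℂ fun i => (ε i : ℂ) • b i with hdef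
  have hhb : ∀ i, h (b i) = (ε i : ℂ) • b i := fun i => by
    have := b.toBasis.constr_basis ℂ (fun i => (ε i : ℂ) • b i) i
    rwa [OrthonormalBasis.coe_toBasis] at this
  have hh : h.IsSymmetric := by
    have hx : ∀ v, h v = ∑ i, (inner ℂ (b i) v * ε i) • b i := by
      intro v
      rw [hdef, Module.Basis.constr_apply_fintype]
      refine Finset.sum_congr rfl fun i _ => ?_
      rw [smul_smul, Module.Basis.equivFun_apply, OrthonormalBasis.coe_toBasis_repr_apply,
        OrthonormalBasis.repr_apply_apply]
    intro v w
    rw [hx, hx, sum_inner, inner_sum]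
    refine Finset.sum_congr rfl fun i _ => ?_
    rw [inner_smul_left, inner_smul_right, map_mul, inner_conj_symm, Complex.conj_ofReal]
    ring
  refine ⟨h, hh, fun r => ?_⟩
  have h1 := sum_apply_eigenvalues_eq (hh.eigenvectorBasis rfl).toBasis b.toBasis (T := h)
    (μ := fun i => (hh.eigenvalues rfl i : ℂ)) (μ' := fun i => (ε i : ℂ))
    (fun i => by
      rw [OrthonormalBasis.coe_toBasis]
      exact hh.apply_eigenvectorBasis rfl i)
    (fun i => by rw [OrthonormalBasis.coe_toBasis]; exact hhb i)
    (fun z => Complex.exp (-β * z) ^ r)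
  refine Eq.trans (Finset.sum_congr rfl fun i _ => ?_) (h1.trans (Finset.sum_congr rfl fun i _ => ?_))
  · push_cast
    rfl
  · have h2 : -β * ε i = Real.log (y i) := by
      rw [hε]
      field_simp
    rw [← Complex.ofReal_neg, ← Complex.ofReal_mul, ← Complex.ofReal_exp, h2, Real.exp_log (hy i)]

variable (S : ParticleSystem V N)

/-- For `N ≤ dim V` the partition function, at one fixed `β ≠ 0` and for all Hermitian one-particle
Hamiltonians, has only one expansion in Schur functions. -/
theorem eq_of_partitionFunction_eq (hN : N ≤ Module.finrank ℂ V) {c C : N.Partition → ℂ} {β : ℝ}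
    (hβ : β ≠ 0)
    (hc : ∀ (h : V →ₗ[ℂ] V) (hh : h.IsSymmetric),
      S.partitionFunction h hh β = ∑ I : N.Partition, c I * schurFunction I
        (fun i : Fin (Module.finrank ℂ V) => ((Real.exp (-β * hh.eigenvalues rfl i) : ℝ) : ℂ)))
    (hC : ∀ (h : V →ₗ[ℂ] V) (hh : h.IsSymmetric),
      S.partitionFunction h hh β = ∑ I : N.Partition, C I * schurFunction I
        (fun i : Fin (Module.finrank ℂ V) => ((Real.exp (-β * hh.eigenvalues rfl i) : ℝ) : ℂ))) :
    c = C := by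
  refine sub_eq_zero.1 (eq_zero_of_sum_mul_schurFunction_eq_zero hN fun y hy => ?_)
  obtain ⟨h, hh, hp⟩ := exists_isSymmetric_power_sums (V := V) hβ hy
  have hs : ∀ I : N.Partition, schurFunction I (fun i => (y i : ℂ)) = schurFunction I
      (fun i : Fin (Module.finrank ℂ V) =>
        ((Real.exp (-β * hh.eigenvalues rfl i) : ℝ) : ℂ)) := fun I => by
    simp only [schurFunction, hp]
  simp only [hs, Pi.sub_apply, sub_mul, Finset.sum_sub_distrib]
  rw [← hc h hh, ← hC h hh, sub_self]

end ParticleSystem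

/-! ### Bose and Fermi statistics -/

section OneDimensional

variable {N : ℕ}

/-- If all permutations act on a one-dimensional space by scalars `ε σ`, the space is a single copy
of a Specht module, on which they act by the same scalars. -/
theorem exists_eq_single_of_smul {W : Type*} [AddCommGroup W] [Module ℂ W]
    {ρ : Representation ℂ (Equiv.Perm (Fin N)) W} {C : N.Partition → ℕ}
    (Φ : Module.Basis (PhaseIndex C) ℂ W)
    (hΦ : ∀ σ j, ρ σ (Φ j) = ∑ j', permutationPhase C σ j' j • Φ j')
    {ε : Equiv.Perm (Fin N) → ℂ} (hε : ∀ σ w, ρ σ w = ε σ • w) (hW : Module.finrank ℂ W = 1) :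
    (∃ I, (∀ σ x, spechtRep I σ x = ε σ • x) ∧ C = Pi.single I 1) ∧
      Fintype.card (PhaseIndex C) = 1 ∧
      ∀ σ, permutationPhase C σ = ε σ • (1 : Matrix _ _ ℂ) := by
  classical
  have hcard : Fintype.card (PhaseIndex C) = 1 := by rw [← Module.finrank_eq_card_basis Φ, hW]
  have hphase : ∀ σ, permutationPhase C σ = ε σ • (1 : Matrix _ _ ℂ) := by
    intro σ
    ext i j
    have h1 := congrArg (fun w => Φ.repr w i) (hΦ σ j)
    simp only [hε, map_smul, map_sum, Finsupp.smul_apply, Finsupp.finsetSum_apply,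
      Module.Basis.repr_self, Finsupp.single_apply, smul_eq_mul, mul_ite, mul_one, mul_zero,
      Finset.sum_ite_eq', Finset.mem_univ, if_true] at h1
    rw [← h1, Matrix.smul_apply, Matrix.one_apply, smul_eq_mul]
    simp only [eq_comm (a := j), mul_ite, mul_one, mul_zero]
  refine ⟨?_, hcard, hphase⟩
  obtain ⟨⟨I, a, b⟩, huniq⟩ := Fintype.card_eq_one_iff.1 hcard
  refine ⟨I, fun σ x => ?_, funext fun J => ?_⟩
  · have hmat : spechtMatrix I σ = ε σ • (1 : Matrix _ _ ℂ) := by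
      ext i j
      have h1 := congrFun (congrFun (hphase σ) ⟨I, i, b⟩) ⟨I, j, b⟩
      rw [permutationPhase, Matrix.blockDiagonal'_apply_eq, Matrix.blockDiagonal_apply_eq] at h1
      rw [h1]
      simp [Matrix.one_apply]
    have h2 : spechtRep I σ = ε σ • LinearMap.id := by
      refine (LinearMap.toMatrix (Module.finBasis ℂ (spechtModule I))
        (Module.finBasis ℂ (spechtModule I))).injective ?_
      rw [map_smul, LinearMap.toMatrix_id]
      exact hmat
    rw [h2]
    rfl
  · by_cases hJ : J = I
    · subst hJ
      rw [Pi.single_eq_same]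
      by_contra hne
      have hb := b.2
      have h1 := huniq ⟨J, a, ⟨0, by omega⟩⟩
      have h2 := huniq ⟨J, a, ⟨1, by omega⟩⟩
      have h3 := h1.trans h2.symm
      simp at h3
    · rw [Pi.single_eq_of_ne hJ]
      by_contra hne
      have hnt : Nontrivial (spechtModule J) :=
        ⟨⟨youngSymmetrizer J, 1, one_mul _⟩, 0, fun h =>
          youngSymmetrizer_ne_zero J (congrArg Subtype.val h)⟩
      have h1 := huniq ⟨J, ⟨0, Module.finrank_pos⟩, ⟨0, Nat.pos_of_ne_zero hne⟩⟩
      exact hJ (congrArg Sigma.fst h1)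

end OneDimensional

namespace ParticleSystem

variable {V : Type*} [NormedAddCommGroup V] [InnerProductSpace ℂ V] [FiniteDimensional ℂ V] {N : ℕ}

/-- For at least `N` one-particle states there is a nonzero tensor on which `S_N` acts by a given
one-dimensional character: the projection of the product of `N` different basis vectors. -/
theorem exists_exchange_eq_smul (hN : N ≤ Module.finrank ℂ V) (ε : Equiv.Perm (Fin N) →* ℂ) :
    ∃ t : NParticle V N, t ≠ 0 ∧ ∀ σ, exchange V N σ t = ε σ • t := by
  classical
  let B := Basis.piTensorProduct (fun _ : Fin N => Module.finBasis ℂ V)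
  let f : Fin N → Fin (Module.finrank ℂ V) := Fin.castLE hN
  refine ⟨∑ τ, ε τ⁻¹ • exchange V N τ (B f), fun h0 => ?_, fun σ => ?_⟩
  · have h1 := congrArg (fun t => B.repr t f) h0
    have h2 : ∀ τ : Equiv.Perm (Fin N), τ ≠ 1 →
        B.repr (ε τ⁻¹ • exchange V N τ (B f)) f = 0 := by
      intro τ hτ
      rw [exchange_basis, map_smul, Module.Basis.repr_self, Finsupp.smul_apply,
        Finsupp.single_apply, if_neg, smul_zero]
      intro hf
      refine hτ (Equiv.ext fun i => ?_)
      have h3 := Fin.castLE_injective hN (congrFun hf (τ i))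
      rw [Equiv.symm_apply_apply] at h3
      exact h3.symm
    simp only [map_sum, Finsupp.finsetSum_apply] at h1
    rw [Finset.sum_eq_single 1 (fun τ _ hτ => h2 τ hτ) (by simp)] at h1
    simp at h1
  · rw [map_sum, Finset.smul_sum, ← Equiv.sum_comp (Equiv.mulLeft σ) fun τ =>
      ε σ • ε τ⁻¹ • exchange V N τ (B f)]
    refine Finset.sum_congr rfl fun τ _ => ?_
    rw [Equiv.coe_mulLeft, smul_smul, mul_comm, ← map_mul ε,
      show (σ * τ)⁻¹ * σ = τ⁻¹ by group, map_smul, map_mul,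
      Module.End.mul_apply]

variable {S : ParticleSystem V N}

/-- For scalar states given by a one-dimensional character of `S_N`, the only scalar wave function
representing the states is, up to scalars, the identity. -/
theorem finrank_waveFunctions_eq_one (hS : S.PermutationInvariant) (hN : N ≤ Module.finrank ℂ V)
    (ε : Equiv.Perm (Fin N) →* ℂ) (hk : S.components = 1)
    (hst : ∀ Ψ, Ψ ∈ S.states ↔ ∀ (σ : Equiv.Perm (Fin N)) (k : Fin S.components),
      exchange V N σ (Ψ k) = ε σ • Ψ k) :
    Module.finrank ℂ S.waveFunctions = 1 ∧ ∀ σ Φ, S.waveRep hS σ Φ = ε σ • Φ := by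
  have : Unique (Fin S.components) := by rw [hk]; infer_instance
  have hcomp : ∀ σ, exchange V N σ ∘ₗ S.component default = ε σ • S.component default :=
    fun σ => LinearMap.ext fun Ψ => (hst Ψ).1 Ψ.2 σ default
  have hW : S.waveFunctions = Submodule.span ℂ {S.component default} := by
    rw [S.waveFunctions_eq_span hS]
    apply le_antisymm
    · rw [Submodule.span_le]
      rintro _ ⟨⟨σ, k⟩, rfl⟩
      obtain rfl := Unique.eq_default k
      change exchange V N σ ∘ₗ S.component default ∈ _
      rw [hcomp]
      exact Submodule.smul_mem _ _ (Submodule.mem_span_singleton_self _)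
    · rw [Submodule.span_le, Set.singleton_subset_iff]
      exact Submodule.subset_span ⟨(1, default), by simp only [map_one]; rfl⟩
  constructor
  · rw [hW]
    refine finrank_span_singleton fun h0 => ?_
    obtain ⟨t, ht, hεt⟩ := exists_exchange_eq_smul (V := V) hN ε
    exact ht (LinearMap.congr_fun h0 ⟨fun _ => t, (hst _).2 fun σ _ => hεt σ⟩)
  · intro σ Φ
    obtain ⟨c, hc⟩ := Submodule.mem_span_singleton.1 (hW.le Φ.2)
    refine Subtype.ext (LinearMap.ext fun Ψ => ?_)
    have h1 := LinearMap.congr_fun (hcomp σ) Ψ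
    rw [coe_waveRep_apply, exchangeMaps_apply, Submodule.coe_smul, ← hc]
    simp only [LinearMap.comp_apply, LinearMap.smul_apply, map_smul] at h1 ⊢
    rw [h1, smul_comm]

end ParticleSystem

end

theorem theorem11 {V : Type*} [NormedAddCommGroup V] [InnerProductSpace ℂ V]
    [FiniteDimensional ℂ V] {N : ℕ} (S : ParticleSystem V N) (hS : S.PermutationInvariant) :
    -- the representations `D^I` are irreducible and pairwise inequivalent
    (∀ I : N.Partition, (spechtRep I).IsIrreducible) ∧
    (∀ I J : N.Partition, Nonempty ((spechtRep I).Equiv (spechtRep J)) → I = J) ∧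
    -- the wave functions are the combinations of the components with their particles exchanged
    S.waveFunctions = Submodule.span ℂ
      (Set.range fun p : Equiv.Perm (Fin N) × Fin S.components =>
        exchange V N p.1 ∘ₗ S.component p.2) ∧
    ∃ C : N.Partition → ℕ,
      -- `C` gives an expansion of the canonical partition function in Schur functions
      (∀ (h : V →ₗ[ℂ] V) (hh : h.IsSymmetric) (β : ℝ),
        S.partitionFunction h hh β = ∑ I : N.Partition, (C I : ℂ) * schurFunction I
          (fun i : Fin (Module.finrank ℂ V) =>
            ((Real.exp (-β * hh.eigenvalues rfl i) : ℝ) : ℂ))) ∧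
      -- and it is the only one, so that it can be read off from the partition function
      (N ≤ Module.finrank ℂ V → ∀ (c : N.Partition → ℂ) (β : ℝ), β ≠ 0 →
        (∀ (h : V →ₗ[ℂ] V) (hh : h.IsSymmetric),
          S.partitionFunction h hh β = ∑ I : N.Partition, c I * schurFunction I
            (fun i : Fin (Module.finrank ℂ V) =>
              ((Real.exp (-β * hh.eigenvalues rfl i) : ℝ) : ℂ))) →
        ∀ I, c I = C I) ∧
      -- exchanging particles acts on the wave function `(Φ_j)_j` by `D = ⨁_I [D^I]^{⊕ C_I}`
      (∃ Φ : Module.Basis (PhaseIndex C) ℂ S.waveFunctions,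
        ∀ (σ : Equiv.Perm (Fin N)) (j : PhaseIndex C) (Ψ : S.states),
          exchange V N σ ((Φ j : S.states →ₗ[ℂ] NParticle V N) Ψ) =
            ∑ j' : PhaseIndex C, permutationPhase C σ j' j •
              (Φ j' : S.states →ₗ[ℂ] NParticle V N) Ψ) ∧
      -- Bose and Fermi statistics: `D` is `1 × 1`, equal to `1` or to the sign
      (N ≤ Module.finrank ℂ V → S.IsBose →
        C = Pi.single (Nat.Partition.indiscrete N) 1 ∧ Fintype.card (PhaseIndex C) = 1 ∧
        ∀ σ : Equiv.Perm (Fin N), permutationPhase C σ = 1) ∧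
      (N ≤ Module.finrank ℂ V → S.IsFermi →
        C = Pi.single (onesPartition N) 1 ∧ Fintype.card (PhaseIndex C) = 1 ∧
        ∀ σ : Equiv.Perm (Fin N),
          permutationPhase C σ = ((Equiv.Perm.sign σ : ℤ) : ℂ) • (1 : Matrix _ _ ℂ)) := by
  obtain ⟨C, Φ, hΦ⟩ := exists_basis_permutationPhase (W := S.waveFunctions) (S.waveRep hS)
  have hZ := S.partitionFunction_eq_sum_schurFunction hS Φ hΦ
  refine ⟨spechtRep_isIrreducible, fun I J => eq_of_spechtRep_equiv, S.waveFunctions_eq_span hS,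
    C, hZ, fun hN c β hβ hc I => ?_, ⟨Φ, fun σ j Ψ => ?_⟩, fun hN hB => ?_, fun hN hF => ?_⟩
  · exact congrFun (S.eq_of_partitionFunction_eq hN (C := fun I => (C I : ℂ)) hβ hc
      fun h hh => hZ h hh β) I
  · have h1 := congrArg (fun Φ' : S.waveFunctions =>
      (Φ' : S.states →ₗ[ℂ] NParticle V N) Ψ) (hΦ σ j)
    simp only [ParticleSystem.coe_waveRep_apply, ParticleSystem.exchangeMaps_apply,
      Submodule.coe_sum, Submodule.coe_smul, LinearMap.sum_apply, LinearMap.smul_apply] at h1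
    exact h1
  · obtain ⟨hW, hε⟩ := ParticleSystem.finrank_waveFunctions_eq_one hS hN 1 hB.1 (by
      simpa using hB.2)
    obtain ⟨⟨I, hI, hC⟩, hcard, hphase⟩ := exists_eq_single_of_smul (W := S.waveFunctions) Φ hΦ hε hW
    have hI' : I = Nat.Partition.indiscrete N :=
      eq_indiscrete_of_trivial fun σ x => (hI σ x).trans (one_smul ℂ x)
    exact ⟨hI' ▸ hC, hcard, fun σ => (hphase σ).trans (one_smul ℂ _)⟩
  · obtain ⟨hW, hε⟩ := ParticleSystem.finrank_waveFunctions_eq_one hS hN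
      ((Int.castRingHom ℂ : ℤ →* ℂ).comp ((Units.coeHom ℤ).comp Equiv.Perm.sign)) hF.1 hF.2
    obtain ⟨⟨I, hI, hC⟩, hcard, hphase⟩ := exists_eq_single_of_smul (W := S.waveFunctions) Φ hΦ hε hW
    have hI' : I = onesPartition N := eq_onesPartition_of_sign hI
    exact ⟨hI' ▸ hC, hcard, hphase⟩
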